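/- Let $T=(V,E)$ be a finite tree whose vertices are the parties of a network, with a designated root $r\in V$. Let $\mathcal H=\mathbb C^D$ with $D\ge 1$, let $\tilde{\mathcal H}^v$ be a finite-dimensional Hilbert space for each $v\in V$, and let $U:\mathcal H\to\bigotimes_{v\in V}\tilde{\mathcal H}^v$ be an isometry. For each edge $e=\{v,w\}\in E$ let $M_e\ge 1$ be an integer and let $|\Phi^+_{M_e}\rangle^e=M_e^{-1/2}\sum_{l=0}^{M_e-1}|l\rangle^v\otimes|l\rangle^w$ be a maximally entangled state shared by $v$ and $w$. Spreading quantum information over $T$ for $U$ is called achievable if there is an LOCC map $\mathcal S$ of the parties such that $$\mathcal S\Bigl(\rho\otimes\bigotimes_{e\in E}|\Phi^+_{M_e}\rangle\langle\Phi^+_{M_e}|\Bigr)=U\rho U^\dagger$$ for every density operator $\rho$ on $\mathcal H$, where the system $\mathcal H$ on the left is located at the party $r$, and on the right each $\tilde{\mathcal H}^v$ is located at the party $v$. Here an LOCC map is a map implemented by local quantum instruments and classical communication, possibly with infinitely many rounds (that is, a limit of the maps obtained by stopping one and the same protocol after more and more rounds). For a vertex $v\ne r$ let $p(v)$ be its parent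 and $D'_v$ the set consisting of $v$ and its descendants, and for $e=\{p(v),v\}$ let $$\tilde\Phi^+_{D,e}=\operatorname{tr}_{R\,(V\setminus D'_v)}|\tilde\Phi^+_D\rangle\langle\tilde\Phi^+_D|,\qquad |\tilde\Phi^+_D\rangle=\frac1{\sqrt D}\sum_{l=0}^{D-1}|l\rangle^R\otimes U|l\rangle,$$ be the reduced state of the code-maximally-entangled state $|\tilde\Phi^+_D\rangle\in\mathbb C^D\otimes\bigotimes_{v\in V}\tilde{\mathcal H}^v$ on the systems of the parties in $D'_v$, where $R$ denotes the reference system $\mathbb C^D$. Then spreading quantum information over $T$ for $U$ is achievable if and only if, for every edge $e=\{p(v),v\}\in E$, $$\log_2 M_e\ \ge\ \log_2\operatorname{rank}\tilde\Phi^+_{D,e}.$$ Moreover, it is achievable if and only if it is achievable by an LOCC map with finitely many rounds. -/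

import Mathlib

open Matrix Filter Topology
open scoped Kronecker ComplexOrder

noncomputable section

/-! ## Systems, operators and linear maps between operator spaces -/

/-- The quantum systems held by the parties `v : V`. Party `v` holds the Hilbert space
`ℂ^(Idx v)` with its computational basis indexed by the finite type `Idx v`. -/
structure LocalSystems (V : Type) where
  Idx : V → Type
  [fin : ∀ v, Fintype (Idx v)]
  [dec : ∀ v, DecidableEq (Idx v)]

attribute [instance] LocalSystems.fin LocalSystems.dec

variable {V : Type} [Fintype V] [DecidableEq V]

/-- Basis labels of the joint space `⨂ v, ℂ^(X.Idx v)`. -/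
abbrev LocalSystems.Joint (X : LocalSystems V) : Type := ∀ v, X.Idx v

/-- Operators on the joint space. -/
abbrev Op (X : LocalSystems V) : Type := Matrix X.Joint X.Joint ℂ

/-- Linear maps from operators on the systems `X` to operators on the systems `Y`. -/
abbrev SuperOp (X Y : LocalSystems V) : Type := Op X →ₗ[ℂ] Op Y

/-- `⨂ v, A v` for operators `A v : ℂ^(X.Idx v) → ℂ^(Y.Idx v)`. -/
def tensorOp {X Y : LocalSystems V} (A : ∀ v, Matrix (Y.Idx v) (X.Idx v) ℂ) :
    Matrix Y.Joint X.Joint ℂ :=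
  Matrix.of fun y x => ∏ v, A v (y v) (x v)

/-- `ρ ↦ K ρ K†`. -/
def conjMap {X Y : LocalSystems V} (K : Matrix Y.Joint X.Joint ℂ) : SuperOp X Y where
  toFun ρ := K * ρ * Kᴴ
  map_add' ρ σ := by rw [Matrix.mul_add, Matrix.add_mul]
  map_smul' c ρ := by simp

/-- A completely positive map `ρ ↦ ∑ a, (op a) ρ (op a)†` from operators on `ℂ^m` to operators
on `ℂ^n`, given by finitely many Kraus operators. -/
structure KrausMap (m n : Type) where
  Label : Type
  [fin : Fintype Label]
  op : Label → Matrix n m ℂ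

attribute [instance] KrausMap.fin

/-- `∑ a, (op a)† (op a)`. The completely positive map is trace preserving iff this is `1`. -/
def KrausMap.effect {m n : Type} [Fintype n] (C : KrausMap m n) : Matrix m m ℂ :=
  ∑ a, (C.op a)ᴴ * C.op a

/-- The tensor product `⨂ v, C v` of completely positive maps applied by the single parties. -/
def productMap {X Y : LocalSystems V} (C : ∀ v, KrausMap (X.Idx v) (Y.Idx v)) : SuperOp X Y :=
  ∑ a : (∀ v, (C v).Label), conjMap (tensorOp fun v => (C v).op (a v))

/-! ## Local operations and classical communication -/

/-- A finite or countable family of linear maps, one for each classical outcome. -/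
structure OutcomeFamily (X Y : LocalSystems V) where
  Outcome : Type
  [countable : Countable Outcome]
  map : Outcome → SuperOp X Y

attribute [instance] OutcomeFamily.countable

/-- The family with a single outcome. -/
def OutcomeFamily.single {X Y : LocalSystems V} (S : SuperOp X Y) : OutcomeFamily X Y where
  Outcome := Unit
  map _ := S

/-- First `J`, and then `F j` if the outcome of `J` was `j`. All outcomes are recorded. -/
def OutcomeFamily.bind {X Y Z : LocalSystems V} (J : OutcomeFamily X Y)
    (F : J.Outcome → OutcomeFamily Y Z) : OutcomeFamily X Z where
  Outcome := Σ j, (F j).Outcome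
  map p := (F p.1).map p.2 ∘ₗ J.map p.1

/-- `J'` is obtained from `J` by remembering only the value `f j` of the outcome `j`. -/
def IsCoarseGraining {X Y : LocalSystems V} (J J' : OutcomeFamily X Y) : Prop :=
  ∃ f : J.Outcome → J'.Outcome, ∀ k ρ,
    HasSum (fun j : {j // f j = k} => J.map j.1 ρ) (J'.map k ρ)

/-- `J` is a one-way local instrument of party `K`: party `K` applies a quantum instrument to its
own system and announces the outcome `j`; depending on `j`, each other party applies a completely
positive trace-preserving map to its own system. -/
def IsOneWayLocal {X Y : LocalSystems V} (K : V) (J : OutcomeFamily X Y) : Prop :=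
  ∃ C : J.Outcome → ∀ v, KrausMap (X.Idx v) (Y.Idx v),
    (∀ j, J.map j = productMap (C j)) ∧
    (∀ j v, v ≠ K → (C j v).effect = 1) ∧
    HasSum (fun j => (C j K).effect) 1

/-- `J'` is LOCC linked to `J`: after `J`, a one-way local instrument is applied, where the
instrument and the party that acts first may depend on the outcome of `J`; then some of the
recorded classical information may be forgotten. -/
def IsLinked {X Y Z : LocalSystems V} (J : OutcomeFamily X Y) (J' : OutcomeFamily X Z) : Prop :=
  ∃ F : J.Outcome → OutcomeFamily Y Z,
    (∀ j, ∃ K, IsOneWayLocal K (F j)) ∧ IsCoarseGraining (J.bind F) J'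

/-- Instruments that are implemented by LOCC in `r` rounds. -/
inductive IsLOCCRounds {X : LocalSystems V} :
    ℕ → ∀ {Y : LocalSystems V}, OutcomeFamily X Y → Prop
  | zero : IsLOCCRounds 0 (OutcomeFamily.single (LinearMap.id : SuperOp X X))
  | succ {r : ℕ} {Y Z : LocalSystems V} {J : OutcomeFamily X Y} {J' : OutcomeFamily X Z} :
      IsLOCCRounds r J → IsLinked J J' → IsLOCCRounds (r + 1) J'

/-- `S` is implemented by LOCC in finitely many rounds. -/
def IsFiniteLOCC {X Y : LocalSystems V} (S : SuperOp X Y) : Prop :=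
  ∃ r, IsLOCCRounds r (OutcomeFamily.single S)

/-- `S` is an LOCC map: there is one protocol `J 0, J 1, …`, possibly with infinitely many rounds,
each step being LOCC linked to the step before, such that the maps `Tν` that result from stopping
after step `ν` (with a last round in which the parties prepare their output systems, and
forgetting all outcomes) converge to `S`. Pointwise convergence is convergence in norm, as all
spaces are finite-dimensional. -/
def IsLOCC {X Y : LocalSystems V} (S : SuperOp X Y) : Prop :=
  ∃ (Z : ℕ → LocalSystems V) (J : ∀ ν, OutcomeFamily X (Z ν)) (T : ℕ → SuperOp X Y),
    (∃ r, IsLOCCRounds r (J 0)) ∧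
    (∀ ν, IsLinked (J ν) (J (ν + 1))) ∧
    (∀ ν, IsLinked (J ν) (OutcomeFamily.single (T ν))) ∧
    ∀ ρ, Tendsto (fun ν => T ν ρ) atTop (𝓝 (S ρ))

/-! ## Spreading quantum information over a network -/

/-- Density operators on `ℂ^n`. -/
def IsDensity {n : Type} [Fintype n] (ρ : Matrix n n ℂ) : Prop :=
  ρ.PosSemidef ∧ ρ.trace = 1

/-- The initial systems: party `root` holds the logical system `ℂ^D`, and for each edge `e`, each
of the two endpoints of `e` holds a system `ℂ^(M e)`. -/
def inputSystems (G : SimpleGraph V) [DecidableRel G.Adj] (root : V) (D : ℕ)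
    (M : G.edgeSet → ℕ) : LocalSystems V where
  Idx v := (v = root → Fin D) × (∀ e : G.edgeSet, v ∈ (e : Sym2 V) → Fin (M e))
  fin _ := inferInstance
  dec _ := Classical.decEq _

/-- The systems `ℂ^(d v)` which the parties hold at the end. -/
def outputSystems (d : V → ℕ) : LocalSystems V where
  Idx v := Fin (d v)

/-- The initial resource state: the tensor product over all edges `e = {v, w}` of the maximally
entangled states `(M e)^(-1/2) ∑ l, |l⟩ ⊗ |l⟩` shared by `v` and `w`, as a function of the basis
labels. -/
def resourceVec (G : SimpleGraph V) [DecidableRel G.Adj] (root : V) (D : ℕ) (M : G.edgeSet → ℕ)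
    (x : (inputSystems G root D M).Joint) : ℂ :=
  open Classical in
  ∏ e : G.edgeSet,
    if ∀ (v w : V) (hv : v ∈ (e : Sym2 V)) (hw : w ∈ (e : Sym2 V)), (x v).2 e hv = (x w).2 e hw
    then (((1 / Real.sqrt (M e) : ℝ)) : ℂ) else 0

/-- The initial state, with `ρ` on the logical system and the resource state on the rest. -/
def initialState (G : SimpleGraph V) [DecidableRel G.Adj] (root : V) {D : ℕ} (M : G.edgeSet → ℕ)
    (ρ : Matrix (Fin D) (Fin D) ℂ) : Op (inputSystems G root D M) :=
  Matrix.of fun x y =>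
    ρ ((x root).1 rfl) ((y root).1 rfl) *
      (resourceVec G root D M x * star (resourceVec G root D M y))

/-- The map `S` applies `U` to an unknown state of party `root` and shares the result, consuming
the resource state. -/
def Spreads (G : SimpleGraph V) [DecidableRel G.Adj] (root : V) {D : ℕ} {d : V → ℕ}
    (U : Matrix (∀ v, Fin (d v)) (Fin D) ℂ) (M : G.edgeSet → ℕ)
    (S : SuperOp (inputSystems G root D M) (outputSystems d)) : Prop :=
  ∀ ρ : Matrix (Fin D) (Fin D) ℂ, IsDensity ρ → S (initialState G root M ρ) = U * ρ * Uᴴ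

/-- Spreading quantum information over `G` for `U` is achievable by LOCC. -/
def SpreadingAchievable (G : SimpleGraph V) [DecidableRel G.Adj] (root : V) {D : ℕ} {d : V → ℕ}
    (U : Matrix (∀ v, Fin (d v)) (Fin D) ℂ) (M : G.edgeSet → ℕ) : Prop :=
  ∃ S : SuperOp (inputSystems G root D M) (outputSystems d), IsLOCC S ∧ Spreads G root U M S

/-- Spreading quantum information over `G` for `U` is achievable by LOCC in finitely many
rounds. -/
def FiniteSpreadingAchievable (G : SimpleGraph V) [DecidableRel G.Adj] (root : V) {D : ℕ}
    {d : V → ℕ} (U : Matrix (∀ v, Fin (d v)) (Fin D) ℂ) (M : G.edgeSet → ℕ) : Prop :=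
  ∃ S : SuperOp (inputSystems G root D M) (outputSystems d),
    IsFiniteLOCC S ∧ Spreads G root U M S

/-! ## Rooted trees and reduced states -/

/-- In the tree `G` with root `root`, the vertex `p` is the parent of `v`: it is the neighbour of
`v` on the path from the root to `v`. -/
def IsParent (G : SimpleGraph V) (root p v : V) : Prop :=
  G.Adj p v ∧ ∃ q : G.Walk root v, q.IsPath ∧ p ∈ q.support

/-- `v` and its descendants: the vertices `w` such that `v` is on the path from the root
to `w`. -/
def subtreeAt (G : SimpleGraph V) (root v : V) : Finset V :=
  open Classical in
  Finset.univ.filter fun w => ∃ q : G.Walk root w, q.IsPath ∧ v ∈ q.support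

/-- The maximally entangled vector `D^(-1/2) ∑ l, |l⟩ ⊗ |l⟩` of `ℂ^D ⊗ ℂ^D`. -/
def maxEntangled (D : ℕ) : Fin D × Fin D → ℂ :=
  fun l => if l.1 = l.2 then (((1 / Real.sqrt D : ℝ)) : ℂ) else 0

/-- The vector `(1 ⊗ U) D^(-1/2) ∑ l, |l⟩ ⊗ |l⟩`, whose first factor is the reference system. -/
def codeMaxEntangled {D : ℕ} {d : V → ℕ} (U : Matrix (∀ v, Fin (d v)) (Fin D) ℂ) :
    Fin D × (∀ v, Fin (d v)) → ℂ :=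
  ((1 : Matrix (Fin D) (Fin D) ℂ) ⊗ₖ U) *ᵥ maxEntangled D

/-- The basis label of the joint system that is `a` on the parties in `A` and `c` on the
others. -/
def glue {d : V → ℕ} (A : Finset V) (a : ∀ v : {v // v ∈ A}, Fin (d v))
    (c : ∀ v : {v // v ∉ A}, Fin (d v)) : ∀ v, Fin (d v) :=
  fun v => if h : v ∈ A then a ⟨v, h⟩ else c ⟨v, h⟩

/-- The partial trace over the reference system and the systems of all parties outside `A`. -/
def partialTrace {D : ℕ} {d : V → ℕ} (A : Finset V)
    (σ : Matrix (Fin D × (∀ v, Fin (d v))) (Fin D × (∀ v, Fin (d v))) ℂ) :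
    Matrix (∀ v : {v // v ∈ A}, Fin (d v)) (∀ v : {v // v ∈ A}, Fin (d v)) ℂ :=
  Matrix.of fun a b =>
    ∑ l : Fin D, ∑ c : (∀ v : {v // v ∉ A}, Fin (d v)), σ (l, glue A a c) (l, glue A b c)

/-- The reduced state of the code-maximally-entangled state on the systems of the parties
in `A`. -/
def reducedCodeState {D : ℕ} {d : V → ℕ} (U : Matrix (∀ v, Fin (d v)) (Fin D) ℂ)
    (A : Finset V) :
    Matrix (∀ v : {v // v ∈ A}, Fin (d v)) (∀ v : {v // v ∈ A}, Fin (d v)) ℂ :=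
  partialTrace A (vecMulVec (codeMaxEntangled U) (star (codeMaxEntangled U)))

end

noncomputable section

set_option linter.unusedSectionVars false

/-! ## Rooted trees as parent functions -/

/-! Necessity. Fix an edge $e=\{p(v),v\}$ and cut the network into the subtree at `v` on one side
and everything else, including the reference system, on the other. Only $e$ crosses the cut, so the
initial vector, with the logical system entangled with the reference, has Schmidt rank at most $M_e$
(`hasSchmidtForm_referenceVec`). The closed cone generated by the rank-one operators of vectors of
Schmidt rank at most $M_e$ is preserved by product Kraus operators, by convergent sums and by
limits, hence also by LOCC with infinitely many rounds (`PreservesSchmidt.of_isLOCC`). The output is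
pure, and a rank-one operator lies in this cone only if its vector has Schmidt rank at most $M_e$
(`rank_le_of_vecMulVec_mem_schmidtCone`). The Schmidt rank of the output across the cut is the rank
of the reduced state.

Sufficiency. For $v\ne r$ the rank bound gives a partial isometry $b_v$ from $\mathbb C^{M_e}$ onto
the span of the slices of $U$ on the subtree of $v$; at the root put $b_r=U$. The tensors
$W_v=(\bigotimes_c b_c^\dagger)\,b_v$, with $c$ running over the children of $v$, are contractions.
Since the projections $b_cb_c^\dagger$ fix $b_v$, contracting the $W_v$ along the tree gives $U$
(`exists_tree_network`).

Acting from the root towards the leaves, each party undoes the teleportation error of its parent,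
applies $W_v$ and teleports the resulting shares to its children by generalized Bell measurements.
Where $W_v$ is not an isometry, extra outcomes complete the instrument. Every combination of Bell
outcomes yields the same multiple of $U$, and their probabilities already add up to one, so the
extra outcomes never occur (`exists_isFiniteLOCC_spreading`). This protocol has finitely many
rounds, so the bounds necessary for infinite-round LOCC are sufficient for finite-round LOCC. -/

/-- A rooted tree on the vertex set `V`, given by the parent function (whose value at the root is
irrelevant) and the sets `subtree v` consisting of `v` and its descendants. -/
structure ParentTree (V : Type) where
  root : V
  par : V → V
  depth : V → ℕ
  depth_par_lt : ∀ v, v ≠ root → depth (par v) < depth v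
  subtree : V → Finset V
  mem_subtree : ∀ v w, w ∈ subtree v ↔ w = v ∨ (w ≠ root ∧ par w ∈ subtree v)

namespace ParentTree

variable {V : Type} (R : ParentTree V)

/-- The children of the vertex `v`. -/
abbrev Child (v : V) : Type := {c : V // c ≠ R.root ∧ R.par c = v}

theorem self_mem_subtree (v : V) : v ∈ R.subtree v := (R.mem_subtree v v).2 (Or.inl rfl)

theorem depth_le_of_mem_subtree {v w : V} (h : w ∈ R.subtree v) : R.depth v ≤ R.depth w := by
  induction hn : R.depth w using Nat.strong_induction_on generalizing w with
  | _ n ih =>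
    rcases (R.mem_subtree v w).1 h with rfl | ⟨hw, hp⟩
    · omega
    · have := R.depth_par_lt w hw
      have := ih _ (by omega) hp rfl
      omega

theorem notMem_subtree_child {v : V} (c : R.Child v) : v ∉ R.subtree c := by
  intro h
  have h1 := R.depth_le_of_mem_subtree h
  have h2 := R.depth_par_lt c c.2.1
  rw [c.2.2] at h2
  omega

theorem subtree_child_subset {v : V} (c : R.Child v) : R.subtree c ⊆ R.subtree v := by
  intro w h
  induction hn : R.depth w using Nat.strong_induction_on generalizing w with
  | _ n ih =>
    rcases (R.mem_subtree c w).1 h with rfl | ⟨hw, hp⟩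
    · exact (R.mem_subtree v _).2 (Or.inr ⟨c.2.1, by rw [c.2.2]; exact R.self_mem_subtree v⟩)
    · have := R.depth_par_lt w hw
      exact (R.mem_subtree v _).2 (Or.inr ⟨hw, ih _ (by omega) hp rfl⟩)

/-- A common vertex can be moved up to its parent until it becomes one of the two children; then `v`
would lie in the subtree of the other child. -/
theorem disjoint_subtree_child {v : V} {c c' : R.Child v} (hc : c ≠ c') :
    Disjoint (R.subtree c) (R.subtree c') := by
  rw [Finset.disjoint_left]
  intro w h h'
  induction hn : R.depth w using Nat.strong_induction_on generalizing w with
  | _ n ih =>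
    rcases (R.mem_subtree c w).1 h with rfl | ⟨hw, hp⟩
    · rcases (R.mem_subtree c' _).1 h' with h2 | ⟨_, hp'⟩
      · exact hc (Subtype.ext h2)
      · rw [c.2.2] at hp'
        exact R.notMem_subtree_child c' hp'
    · rcases (R.mem_subtree c' w).1 h' with rfl | ⟨_, hp'⟩
      · rw [c'.2.2] at hp
        exact R.notMem_subtree_child c hp
      · exact ih _ (by have := R.depth_par_lt w hw; omega) hp hp' rfl

theorem exists_mem_subtree_child {v w : V} (h : w ∈ R.subtree v) (hne : w ≠ v) :
    ∃ c : R.Child v, w ∈ R.subtree c := by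
  induction hn : R.depth w using Nat.strong_induction_on generalizing w with
  | _ n ih =>
    rcases (R.mem_subtree v w).1 h with rfl | ⟨hw, hp⟩
    · exact absurd rfl hne
    · by_cases hpv : R.par w = v
      · exact ⟨⟨w, hw, hpv⟩, R.self_mem_subtree _⟩
      · obtain ⟨c, hc⟩ := ih _ (by have := R.depth_par_lt w hw; omega) hp hpv rfl
        exact ⟨c, (R.mem_subtree _ _).2 (Or.inr ⟨hw, hc⟩)⟩

theorem mem_subtree_root (w : V) : w ∈ R.subtree R.root := by
  induction hn : R.depth w using Nat.strong_induction_on generalizing w with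
  | _ n ih =>
    by_cases hw : w = R.root
    · exact (R.mem_subtree _ _).2 (Or.inl hw)
    · exact (R.mem_subtree _ _).2 (Or.inr ⟨hw, ih _
        (by have := R.depth_par_lt w hw; omega) _ rfl⟩)

theorem root_notMem_subtree {v : V} (hv : v ≠ R.root) : R.root ∉ R.subtree v := by
  intro h
  rcases (R.mem_subtree v _).1 h with h | h
  · exact hv h.symm
  · exact h.1 rfl

end ParentTree

/-! ### Paths from the root and parent edges in a graph-theoretic tree -/

section OfTree

variable {V : Type} {T : SimpleGraph V} (hT : T.IsTree) (root : V)

/-- The path from the root to `v` in a tree. -/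
def rootPath (v : V) : T.Walk root v := (hT.existsUnique_path root v).choose

theorem rootPath_isPath (v : V) : (rootPath hT root v).IsPath :=
  (hT.existsUnique_path root v).choose_spec.1

theorem eq_rootPath {v : V} (q : T.Walk root v) (hq : q.IsPath) : q = rootPath hT root v :=
  (hT.existsUnique_path root v).choose_spec.2 q hq

theorem rootPath_root : rootPath hT root root = SimpleGraph.Walk.nil :=
  (eq_rootPath hT root _ SimpleGraph.Walk.IsPath.nil).symm

theorem isParent_iff_mem {V : Type} {T : SimpleGraph V} (hT : T.IsTree) (root p v : V) :
    IsParent T root p v ↔ T.Adj p v ∧ p ∈ (rootPath hT root v).support := by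
  constructor
  · rintro ⟨h, q, hq, hp⟩
    exact ⟨h, eq_rootPath hT root q hq ▸ hp⟩
  · rintro ⟨h, hp⟩
    exact ⟨h, _, rootPath_isPath hT root v, hp⟩

theorem mem_subtreeAt_iff [Fintype V] (v w : V) :
    w ∈ subtreeAt T root v ↔ v ∈ (rootPath hT root w).support := by
  simp only [subtreeAt, Finset.mem_filter, Finset.mem_univ, true_and]
  constructor
  · rintro ⟨q, hq, hp⟩
    exact eq_rootPath hT root q hq ▸ hp
  · intro hp
    exact ⟨_, rootPath_isPath hT root w, hp⟩

/-- The path to `v` passes through `p`, so its initial segment is the path to `p` and misses `v`.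
Appending the edge gives a path, and paths in a tree are unique. -/
theorem rootPath_concat_of_isParent {p v : V} (h : IsParent T root p v) :
    (rootPath hT root p).concat h.1 = rootPath hT root v := by
  classical
  apply eq_rootPath
  have hp := ((isParent_iff_mem hT root p v).1 h).2
  have h1 : (rootPath hT root v).takeUntil p hp = rootPath hT root p :=
    eq_rootPath hT root _ ((rootPath_isPath hT root v).takeUntil hp)
  refine (rootPath_isPath hT root p).concat ?_ h.1
  rw [← h1]
  exact SimpleGraph.Walk.endpoint_notMem_support_takeUntil (rootPath_isPath hT root v) hp h.1.ne'

/-- If `b` is not on the path to `a`, that path can be prolonged by the edge, and the path to `b`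
then runs through `a`. -/
theorem isParent_or_isParent {V : Type} {T : SimpleGraph V} (hT : T.IsTree) (root : V) {a b : V} (h : T.Adj a b) :
    IsParent T root a b ∨ IsParent T root b a := by
  by_cases hb : b ∈ (rootPath hT root a).support
  · exact Or.inr ((isParent_iff_mem hT root b a).2 ⟨h.symm, hb⟩)
  · left
    refine (isParent_iff_mem hT root a b).2 ⟨h, ?_⟩
    rw [← eq_rootPath hT root _ ((rootPath_isPath hT root a).concat hb h),
      SimpleGraph.Walk.support_concat]
    simp

theorem not_isParent_root {V : Type} {T : SimpleGraph V} (hT : T.IsTree) (root p : V) : ¬ IsParent T root p root := by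
  intro h
  have := ((isParent_iff_mem hT root p root).1 h).2
  rw [rootPath_root] at this
  simp only [SimpleGraph.Walk.support_nil, List.mem_singleton] at this
  exact h.1.ne this

/-- The neighbour of `v` on the path from the root to `v`. -/
def parent (v : V) : V := (rootPath hT root v).penultimate

theorem isParent_parent {v : V} (hv : v ≠ root) : IsParent T root (parent hT root v) v := by
  have hn : ¬ (rootPath hT root v).Nil := fun h => hv h.eq.symm
  exact (isParent_iff_mem hT root _ v).2 ⟨SimpleGraph.Walk.adj_penultimate hn,
    SimpleGraph.Walk.getVert_mem_support _ _⟩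

theorem isParent_iff (p v : V) : IsParent T root p v ↔ v ≠ root ∧ p = parent hT root v := by
  constructor
  · intro h
    refine ⟨?_, ?_⟩
    · rintro rfl
      exact not_isParent_root hT v p h
    · rw [parent, ← rootPath_concat_of_isParent hT root h, SimpleGraph.Walk.penultimate_concat]
  · rintro ⟨hv, rfl⟩
    exact isParent_parent hT root hv

/-- The tree `T` with the root `root`. -/
def rootedTree [Fintype V] : ParentTree V where
  root := root
  par := parent hT root
  depth v := (rootPath hT root v).length
  depth_par_lt v hv := by
    rw [← rootPath_concat_of_isParent hT root (isParent_parent hT root hv),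
      SimpleGraph.Walk.length_concat]
    omega
  subtree := subtreeAt T root
  mem_subtree v w := by
    rw [mem_subtreeAt_iff hT, mem_subtreeAt_iff hT]
    by_cases hw : w = root
    · subst hw
      rw [rootPath_root]
      simp [eq_comm]
    · rw [← rootPath_concat_of_isParent hT root (isParent_parent hT root hw),
        SimpleGraph.Walk.support_concat]
      simp [hw, or_comm, eq_comm]

/-- The edge above a vertex. -/
def parentEdge (v : V) (hv : v ≠ root) : T.edgeSet :=
  ⟨s(parent hT root v, v), (isParent_parent hT root hv).1⟩

theorem parentEdge_injective [Fintype V] {v w : V} (hv : v ≠ root) (hw : w ≠ root)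
    (h : parentEdge hT root v hv = parentEdge hT root w hw) : v = w := by
  have h1 := congrArg Subtype.val h
  simp only [parentEdge, Sym2.eq_iff] at h1
  rcases h1 with h1 | ⟨h1, h2⟩
  · exact h1.2
  -- With swapped endpoints each vertex would be the parent of the other, so each depth would be
  -- smaller than the other.
  · exfalso
    have h3 := (rootedTree hT root).depth_par_lt v hv
    have h4 := (rootedTree hT root).depth_par_lt w hw
    change (rootedTree hT root).depth (parent hT root v) < _ at h3
    change (rootedTree hT root).depth (parent hT root w) < _ at h4
    rw [h1] at h3
    rw [← h2] at h4
    omega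

theorem parentEdge_surjective (e : T.edgeSet) : ∃ v hv, parentEdge hT root v hv = e := by
  obtain ⟨e, he⟩ := e
  induction e using Sym2.ind with
  | _ a b =>
    rcases isParent_or_isParent hT root (show T.Adj a b from he) with h | h
    · obtain ⟨hb, rfl⟩ := (isParent_iff hT root a b).1 h
      exact ⟨b, hb, rfl⟩
    · obtain ⟨hb, rfl⟩ := (isParent_iff hT root b a).1 h
      exact ⟨a, hb, Subtype.ext Sym2.eq_swap⟩

/-- The edges of a rooted tree correspond to its vertices other than the root. -/
def parentEdgeEquiv [Fintype V] : {v : V // v ≠ root} ≃ T.edgeSet :=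
  Equiv.ofBijective (fun v => parentEdge hT root v.1 v.2)
    ⟨fun v w h => Subtype.ext (parentEdge_injective hT root v.2 w.2 h), fun e => by
      obtain ⟨v, hv, h⟩ := parentEdge_surjective hT root e
      exact ⟨⟨v, hv⟩, h⟩⟩

end OfTree

/-! ## Product operators -/

section ProductOperators

variable {V : Type} [Fintype V] [DecidableEq V] {X Y Z : LocalSystems V}

theorem tensorOp_mul (B : ∀ v, Matrix (Z.Idx v) (Y.Idx v) ℂ)
    (A : ∀ v, Matrix (Y.Idx v) (X.Idx v) ℂ) :
    tensorOp B * tensorOp A = tensorOp fun v => B v * A v := by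
  ext z x
  simp only [Matrix.mul_apply, tensorOp, Matrix.of_apply, ← Finset.prod_mul_distrib]
  rw [Finset.prod_univ_sum, Fintype.piFinset_univ]

omit [DecidableEq V] in
theorem tensorOp_conjTranspose (A : ∀ v, Matrix (Y.Idx v) (X.Idx v) ℂ) :
    (tensorOp A)ᴴ = tensorOp (X := Y) (Y := X) fun v => (A v)ᴴ := by
  ext z x
  simp [tensorOp, Matrix.conjTranspose_apply]

omit [DecidableEq V] in
theorem tensorOp_one : tensorOp (X := X) (Y := X) (fun _ => 1) = 1 := by
  ext z x
  simp only [tensorOp, Matrix.of_apply, Matrix.one_apply]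
  by_cases h : z = x
  · subst h; simp
  · rw [if_neg h]
    obtain ⟨v, hv⟩ := Function.ne_iff.1 h
    exact Finset.prod_eq_zero (Finset.mem_univ v) (if_neg hv)

omit [DecidableEq V] in
theorem tensorOp_eq_zero (A : ∀ v, Matrix (Y.Idx v) (X.Idx v) ℂ) (v : V) (h : A v = 0) :
    tensorOp A = 0 := by
  ext y x
  simp only [tensorOp, Matrix.of_apply, Matrix.zero_apply]
  exact Finset.prod_eq_zero (Finset.mem_univ v) (by rw [h]; rfl)

theorem conjMap_apply (K : Matrix Y.Joint X.Joint ℂ) (ρ : Op X) :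
    conjMap K ρ = K * ρ * Kᴴ := rfl

theorem conjMap_comp (L : Matrix Z.Joint Y.Joint ℂ) (K : Matrix Y.Joint X.Joint ℂ) :
    conjMap L ∘ₗ conjMap K = conjMap (L * K) := by
  ext1 ρ
  simp only [LinearMap.comp_apply, conjMap_apply, Matrix.conjTranspose_mul, Matrix.mul_assoc]

theorem conjMap_one : conjMap (1 : Op X) = LinearMap.id := by
  ext1 ρ
  simp [conjMap_apply]

theorem conjMap_zero : conjMap (0 : Matrix Y.Joint X.Joint ℂ) = 0 := by
  ext1 ρ
  simp [conjMap_apply]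

/-- The completely positive map with a single Kraus operator. -/
def KrausMap.ofOp {m n : Type} (K : Matrix n m ℂ) : KrausMap m n where
  Label := Unit
  op _ := K

theorem KrausMap.ofOp_effect {m n : Type} [Fintype n] (K : Matrix n m ℂ) :
    (KrausMap.ofOp K).effect = Kᴴ * K := by
  exact Fintype.sum_unique (ι := Unit) _

theorem productMap_ofOp (K : ∀ v, Matrix (Y.Idx v) (X.Idx v) ℂ) :
    productMap (fun v => KrausMap.ofOp (K v)) = conjMap (tensorOp K) := by
  unfold productMap
  have : Unique (∀ v, (KrausMap.ofOp (K v)).Label) :=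
    inferInstanceAs (Unique (∀ _ : V, Unit))
  rw [Fintype.sum_unique]
  rfl

end ProductOperators

/-! ## Basic LOCC protocols -/

section Protocols

variable {V : Type} [Fintype V] [DecidableEq V] {X Y : LocalSystems V}

/-- The instrument with the Kraus operators `⨂ v, L i v`, one for each outcome `i`. -/
abbrev OutcomeFamily.ofOps {ι : Type} [Countable ι]
    (L : ι → ∀ v, Matrix (Y.Idx v) (X.Idx v) ℂ) : OutcomeFamily X Y where
  Outcome := ι
  map i := conjMap (tensorOp (L i))

theorem isOneWayLocal_ofOps {ι : Type} [Fintype ι] (K : V)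
    (L : ι → ∀ v, Matrix (Y.Idx v) (X.Idx v) ℂ) (h : ∀ i v, v ≠ K → (L i v)ᴴ * L i v = 1)
    (hK : ∑ i, (L i K)ᴴ * L i K = 1) : IsOneWayLocal K (OutcomeFamily.ofOps L) := by
  refine ⟨fun i v => KrausMap.ofOp (L i v), fun i => (productMap_ofOp _).symm, fun i v hv => ?_, ?_⟩
  · rw [KrausMap.ofOp_effect]
    exact h i v hv
  · have h2 := hasSum_fintype (fun i => (L i K)ᴴ * L i K)
    rw [hK] at h2
    refine h2.congr_fun ?_
    intro i
    rw [KrausMap.ofOp_effect]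

theorem sum_tensorOp_effect {ι : Type} [Fintype ι] (K : V)
    (L : ι → ∀ v, Matrix (Y.Idx v) (X.Idx v) ℂ) (h : ∀ i v, v ≠ K → (L i v)ᴴ * L i v = 1)
    (hK : ∑ i, (L i K)ᴴ * L i K = 1) : ∑ i, (tensorOp (L i))ᴴ * tensorOp (L i) = 1 := by
  simp only [tensorOp_conjTranspose, tensorOp_mul]
  rw [← tensorOp_one]
  ext x y
  simp only [Matrix.sum_apply, tensorOp, Matrix.of_apply]
  have h1 : ∀ i, ∏ v, ((L i v)ᴴ * L i v) (x v) (y v) = ((L i K)ᴴ * L i K) (x K) (y K) *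
      ∏ v ∈ Finset.univ.erase K, (1 : Matrix (X.Idx v) (X.Idx v) ℂ) (x v) (y v) := by
    intro i
    rw [← Finset.mul_prod_erase _ _ (Finset.mem_univ K)]
    congr 1
    refine Finset.prod_congr rfl fun v hv => ?_
    rw [h i v (Finset.ne_of_mem_erase hv)]
  simp only [h1]
  rw [← Finset.sum_mul, ← Matrix.sum_apply, hK, Finset.mul_prod_erase _
    (fun v => (1 : Matrix (X.Idx v) (X.Idx v) ℂ) (x v) (y v)) (Finset.mem_univ K)]

/-- All parties apply isometries, and all outcomes of the instrument before are forgotten. -/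
theorem isLinked_single_sum_comp [Nonempty V] {Z : LocalSystems V} (J : OutcomeFamily X Y)
    [Fintype J.Outcome] (L : ∀ v, Matrix (Z.Idx v) (Y.Idx v) ℂ) (hL : ∀ v, (L v)ᴴ * L v = 1) :
    IsLinked J (OutcomeFamily.single (∑ j, conjMap (tensorOp L) ∘ₗ J.map j)) := by
  obtain ⟨K⟩ := ‹Nonempty V›
  refine ⟨fun _ => OutcomeFamily.ofOps (ι := Unit) fun _ => L, fun _ => ⟨K,
    isOneWayLocal_ofOps K _ (fun _ v _ => hL v) (by simp [hL])⟩, fun _ => (), fun k ρ => ?_⟩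
  -- There is only one final outcome, so its fibre consists of all outcomes of `J`.
  let e : J.Outcome ≃ {j : (J.bind fun _ => OutcomeFamily.ofOps (ι := Unit) fun _ => L).Outcome //
      () = k} :=
    { toFun := fun j => ⟨⟨j, ()⟩, rfl⟩
      invFun := fun j => j.1.1
      left_inv := fun _ => rfl
      right_inv := fun _ => rfl }
  have h : (OutcomeFamily.single (∑ j, conjMap (tensorOp L) ∘ₗ J.map j)).map k ρ
      = ∑ j, (conjMap (tensorOp L) ∘ₗ J.map j) ρ := by
    simp only [OutcomeFamily.single, LinearMap.sum_apply]
  rw [h]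
  exact e.hasSum_iff.1 (hasSum_fintype (fun j => (conjMap (tensorOp L) ∘ₗ J.map j) ρ))

theorem isLinked_single_self [Nonempty V] (S : SuperOp X Y) :
    IsLinked (OutcomeFamily.single S) (OutcomeFamily.single S) := by
  let _ : Fintype (OutcomeFamily.single S).Outcome := inferInstanceAs (Fintype Unit)
  have := isLinked_single_sum_comp (OutcomeFamily.single S)
    (fun v => (1 : Matrix (Y.Idx v) (Y.Idx v) ℂ)) (by simp)
  rw [tensorOp_one, conjMap_one] at this
  have h : ∑ j, LinearMap.id ∘ₗ (OutcomeFamily.single S).map j = S :=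
    Fintype.sum_unique (ι := Unit) _
  rwa [h] at this

/-- The finite protocol is continued by rounds in which nothing happens, which gives a constant
sequence. -/
theorem IsFiniteLOCC.isLOCC [Nonempty V] {S : SuperOp X Y} (h : IsFiniteLOCC S) : IsLOCC S :=
  ⟨fun _ => Y, fun _ => OutcomeFamily.single S, fun _ => S, h, fun _ => isLinked_single_self S,
    fun _ => isLinked_single_self S, fun _ => tendsto_const_nhds⟩

end Protocols

/-! ## Protocols in which every party acts once -/

section Sequential

/-- The index set of a party which has already acted or has not acted yet. -/
def MixedIdx (A B : Type) : Bool → Type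
  | true => B
  | false => A

instance {A B : Type} [Fintype A] [Fintype B] (b : Bool) : Fintype (MixedIdx A B b) :=
  match b with
  | true => inferInstanceAs (Fintype B)
  | false => inferInstanceAs (Fintype A)

instance {A B : Type} [DecidableEq A] [DecidableEq B] (b : Bool) :
    DecidableEq (MixedIdx A B b) :=
  match b with
  | true => inferInstanceAs (DecidableEq B)
  | false => inferInstanceAs (DecidableEq A)

/-- The operator `K` if the party has acted; before that, `1` or `0` depending on `ok`. -/
def mixedOp {A B : Type} [DecidableEq A] (K : Matrix B A ℂ) (ok : Prop) [Decidable ok] :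
    ∀ b : Bool, Matrix (MixedIdx A B b) A ℂ
  | true => K
  | false => if ok then (1 : Matrix A A ℂ) else 0

/-- The operator that identifies the system of a party that has acted with its final system. -/
def mixedFinish {A B : Type} [DecidableEq B] : ∀ b : Bool, Matrix B (MixedIdx A B b) ℂ
  | true => (1 : Matrix B B ℂ)
  | false => 0

theorem mixedFinish_effect {A B : Type} [Fintype B] [DecidableEq A] [DecidableEq B] {b : Bool}
    (hb : b = true) :
    (mixedFinish (A := A) (B := B) b)ᴴ * mixedFinish (A := A) (B := B) b = 1 := by
  subst hb
  exact (by simp : ((1 : Matrix B B ℂ))ᴴ * 1 = 1)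

theorem mixedFinish_mul_mixedOp {A B : Type} [Fintype A] [Fintype B] [DecidableEq A]
    [DecidableEq B] (K : Matrix B A ℂ) (ok : Prop) [Decidable ok] {b : Bool} (hb : b = true) :
    mixedFinish b * mixedOp K ok b = K := by
  subst hb
  exact Matrix.one_mul K

theorem mixedOp_congr {A B : Type} [DecidableEq A] (K K' : Matrix B A ℂ) (ok ok' : Prop)
    [Decidable ok] [Decidable ok'] (b : Bool) (h : b = false ∧ (ok ↔ ok') ∨ b = true ∧ K = K') :
    mixedOp K ok b = mixedOp K' ok' b := by
  rcases h with ⟨rfl, h⟩ | ⟨rfl, h⟩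
  · simp only [mixedOp, h]
  · exact h

theorem mixedOp_effect_of_false {A B : Type} [Fintype A] [Fintype B] [DecidableEq A]
    (K : Matrix B A ℂ) (ok : Prop) [Decidable ok] {b : Bool} (hok : ok) (hb : b = false) :
    (mixedOp K ok b)ᴴ * mixedOp K ok b = 1 := by
  subst hb
  change (if ok then (1 : Matrix A A ℂ) else 0)ᴴ * (if ok then (1 : Matrix A A ℂ) else 0) = 1
  simp [hok]

theorem mixedOp_eq_zero {A B : Type} [DecidableEq A]
    (K : Matrix B A ℂ) (ok : Prop) [Decidable ok] {b : Bool} (hok : ¬ ok) (hb : b = false) :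
    mixedOp K ok b = 0 := by
  subst hb
  exact if_neg hok

/-- The operator `K` in the step in which the party acts, and `1` when nothing changes. -/
def mixedStep {A B : Type} [DecidableEq A] [DecidableEq B] (K : Matrix B A ℂ) :
    ∀ b b' : Bool, Matrix (MixedIdx A B b') (MixedIdx A B b) ℂ
  | false, true => K
  | true, true => (1 : Matrix B B ℂ)
  | false, false => (1 : Matrix A A ℂ)
  | true, false => 0

theorem mixedStep_effect_of_eq {A B : Type} [Fintype A] [Fintype B] [DecidableEq A]
    [DecidableEq B] (K : Matrix B A ℂ) {b b' : Bool} (h : b = b') :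
    (mixedStep K b b')ᴴ * mixedStep K b b' = 1 := by
  subst h
  cases b
  · exact (by simp : ((1 : Matrix A A ℂ))ᴴ * 1 = 1)
  · exact (by simp : ((1 : Matrix B B ℂ))ᴴ * 1 = 1)

theorem mixedStep_mul_mixedOp_of_eq {A B : Type} [Fintype A] [Fintype B] [DecidableEq A]
    [DecidableEq B] (K K' : Matrix B A ℂ) (ok : Prop) [Decidable ok] {b b' : Bool} (h : b = b') :
    mixedStep K b b' * mixedOp K' ok b = mixedOp K' ok b' := by
  subst h
  cases b
  · exact Matrix.one_mul (if ok then (1 : Matrix A A ℂ) else 0)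
  · exact Matrix.one_mul K'

theorem mixedStep_mul_mixedOp_of_act {A B : Type} [Fintype A] [Fintype B] [DecidableEq A]
    [DecidableEq B] (K K' : Matrix B A ℂ) (ok : Prop) [Decidable ok] {b b' : Bool}
    (h : b = false) (h' : b' = true) :
    mixedStep K b b' * mixedOp K' ok b = if ok then mixedOp K ok b' else 0 := by
  subst h h'
  change K * (if ok then (1 : Matrix A A ℂ) else 0) = if ok then K else 0
  split_ifs <;> simp

theorem mixedStep_effect_of_act {A B ι : Type} [Fintype A] [Fintype B] [DecidableEq A]
    [DecidableEq B] [Fintype ι] (K : ι → Matrix B A ℂ) (hK : ∑ i, (K i)ᴴ * K i = 1) {b b' : Bool}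
    (h : b = false) (h' : b' = true) :
    ∑ i, (mixedStep (K i) b b')ᴴ * mixedStep (K i) b b' = 1 := by
  subst h h'
  exact hK

/-- Summation over families, one coordinate split off. -/
theorem sum_eq_sum_update {V : Type} [Fintype V] [DecidableEq V] {O : V → Type}
    [∀ v, Fintype (O v)] [∀ v, DecidableEq (O v)] {M : Type*} [AddCommMonoid M] (a : V)
    (d : O a) (g : (∀ v, O v) → M) :
    ∑ k, g k = ∑ o : ∀ v, O v, ∑ i : O a, if o a = d then g (Function.update o a i) else 0 := by
  have h1 : ∀ o : ∀ v, O v, (∑ i : O a, if o a = d then g (Function.update o a i) else 0)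
      = if o a = d then ∑ i : O a, g (Function.update o a i) else 0 := by
    intro o
    split_ifs <;> simp
  simp only [h1]
  rw [← Finset.sum_filter, ← Finset.sum_product']
  symm
  refine Finset.sum_bij' (fun p _ => Function.update p.1 a p.2)
    (fun k _ => (Function.update k a d, k a)) ?_ ?_ ?_ ?_ ?_
  · simp
  · simp
  · rintro ⟨o, i⟩ h
    simp only [Finset.mem_product, Finset.mem_filter, Finset.mem_univ, true_and, and_true] at h
    subst h
    simp
  · simp
  · simp

variable {V : Type} [Fintype V] [DecidableEq V] (X Y : LocalSystems V)

/-- The systems when the parties in `s` hold their systems of `Y` and the others still hold their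
systems of `X`. -/
abbrev mixedSystems (s : Finset V) : LocalSystems V where
  Idx v := MixedIdx (X.Idx v) (Y.Idx v) (decide (v ∈ s))

variable {X Y} {O : V → Type} [∀ v, Fintype (O v)] [∀ v, DecidableEq (O v)]
  (K : ∀ v, (∀ u, O u) → Matrix (Y.Idx v) (X.Idx v) ℂ) (d : ∀ v, O v)

/-- The Kraus operator after the parties in `s` have acted with the outcomes `o`, where the
outcomes of the other parties have their default values. -/
def partialOp (s : Finset V) (o : ∀ v, O v) : Matrix (mixedSystems X Y s).Joint X.Joint ℂ :=
  tensorOp (X := X) (Y := mixedSystems X Y s) fun v => mixedOp (K v o) (o v = d v) (decide (v ∈ s))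

/-- The instrument after the parties in `s` have acted. -/
abbrev partialFamily (s : Finset V) : OutcomeFamily X (mixedSystems X Y s) where
  Outcome := ∀ v, O v
  map o := conjMap (partialOp K d s o)

/-- The operator of the step in which the party `a` acts. -/
def stepOp (s : Finset V) (a : V) (o : ∀ v, O v) :
    Matrix (mixedSystems X Y (insert a s)).Joint (mixedSystems X Y s).Joint ℂ :=
  tensorOp (X := mixedSystems X Y s) (Y := mixedSystems X Y (insert a s)) fun v =>
    mixedStep (K v o) (decide (v ∈ s)) (decide (v ∈ insert a s))

variable {K d} {t : V → ℕ}
  (hdep : ∀ v (o o' : ∀ u, O u), o v = o' v → (∀ u, t u < t v → o u = o' u) → K v o = K v o')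
  (hK : ∀ v (o : ∀ u, O u), ∑ i, (K v (Function.update o v i))ᴴ * K v (Function.update o v i) = 1)

-- The outcome of a party that has not acted is pinned to the default `d`: all other labels carry
-- the zero operator. Changing the outcome of `a` leaves the operators of the parties in `s`
-- unchanged, because these depend on their own outcome and on strictly earlier parties only, and
-- nobody in `s` is later than `a`.
omit [∀ v, Fintype (O v)] in
include hdep in
theorem stepOp_mul_partialOp {s : Finset V} {a : V} (ha : a ∉ s) (hs : ∀ v ∈ s, t v ≤ t a)
    (o : ∀ v, O v) (i : O a) :
    stepOp K s a (Function.update o a i) * partialOp K d s o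
      = if o a = d a then partialOp K d (insert a s) (Function.update o a i) else 0 := by
  unfold stepOp partialOp
  rw [tensorOp_mul]
  by_cases hoa : o a = d a
  · rw [if_pos hoa]
    congr 1
    funext v
    by_cases hv : v = a
    · subst hv
      refine (mixedStep_mul_mixedOp_of_act _ _ _ (by simpa using ha) (by simp)).trans ?_
      rw [if_pos hoa]
      have : decide (v ∈ insert v s) = true := by simp
      rw [this]
      rfl
    · refine (mixedStep_mul_mixedOp_of_eq _ _ _ (by simp [hv])).trans ?_
      apply mixedOp_congr
      by_cases hvs : v ∈ s
      · refine Or.inr ⟨by simp [hvs], ?_⟩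
        apply hdep
        · rw [Function.update_of_ne hv]
        · intro u hu
          rw [Function.update_of_ne]
          rintro rfl
          have := hs v hvs
          omega
      · refine Or.inl ⟨by simp [hv, hvs], ?_⟩
        rw [Function.update_of_ne hv]
  · rw [if_neg hoa]
    apply tensorOp_eq_zero _ a
    refine (mixedStep_mul_mixedOp_of_act _ _ _ (by simpa using ha) (by simp)).trans ?_
    rw [if_neg hoa]

variable (d) in
include hdep hK in
theorem isLinked_partialFamily {s : Finset V} {a : V} (ha : a ∉ s) (hs : ∀ v ∈ s, t v ≤ t a) :
    IsLinked (partialFamily K d s) (partialFamily K d (insert a s)) := by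
  let F : (∀ v, O v) → OutcomeFamily (mixedSystems X Y s) (mixedSystems X Y (insert a s)) :=
    fun o => OutcomeFamily.ofOps (ι := O a) fun i v => mixedStep (K v (Function.update o a i))
      (decide (v ∈ s)) (decide (v ∈ insert a s))
  have h : ∀ (o : ∀ v, O v) (i : O a) ρ, (F o).map i (conjMap (partialOp K d s o) ρ)
        = if o a = d a then conjMap (partialOp K d (insert a s) (Function.update o a i)) ρ
          else 0 := by
    intro o i ρ
    change (conjMap (stepOp K s a (Function.update o a i)) ∘ₗ conjMap (partialOp K d s o)) ρ = _
    rw [conjMap_comp, stepOp_mul_partialOp hdep ha hs]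
    split_ifs
    · rfl
    · rw [conjMap_zero]; rfl
  refine ⟨F, fun o => ⟨a, isOneWayLocal_ofOps a _ ?_ ?_⟩, fun p => Function.update p.1 a p.2,
    fun k ρ => ?_⟩
  · intro i v hv
    exact mixedStep_effect_of_eq _ (by simp [hv])
  · exact mixedStep_effect_of_act (fun i : O a => K a (Function.update o a i)) (hK a o)
      (b := decide (a ∈ s)) (b' := decide (a ∈ insert a s)) (by simpa using ha) (by simp)
  -- In the fibre over `k` the only pair that can contribute is `k` with its entry at `a` reset to
  -- the default, followed by the outcome `k a`.
  · have hk : Function.update (Function.update k a (d a)) a (k a) = k := by simp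
    have h3 := h (Function.update k a (d a)) (k a) ρ
    rw [hk, if_pos (by simp)] at h3
    change HasSum _ (conjMap (partialOp K d (insert a s) k) ρ)
    rw [← h3]
    refine hasSum_single (f := fun j : {j : Σ _ : (∀ v, O v), O a // Function.update j.1 a j.2 = k} =>
      (F j.1.1).map j.1.2 (conjMap (partialOp K d s j.1.1) ρ))
      ⟨⟨Function.update k a (d a), k a⟩, hk⟩ ?_
    rintro ⟨⟨o, i⟩, hoi⟩ hne
    refine (h o i ρ).trans (if_neg fun hoa => hne ?_)
    subst hoi
    have : Function.update (Function.update o a i) a (d a) = o := by simp [← hoa]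
    apply Subtype.ext
    refine Sigma.ext this.symm ?_
    simp

omit [∀ v, Fintype (O v)] in
theorem partialOp_empty_eq_zero {o : ∀ v, O v} (ho : o ≠ d) : partialOp K d ∅ o = 0 := by
  obtain ⟨v, hv⟩ := Function.ne_iff.1 ho
  exact tensorOp_eq_zero _ v (mixedOp_eq_zero _ _ hv (by simp))

variable (K d) in
theorem isLOCCRounds_partialFamily_empty [Nonempty V] :
    IsLOCCRounds 1 (partialFamily K d ∅) := by
  obtain ⟨a⟩ := ‹Nonempty V›
  refine .succ (J := OutcomeFamily.single (LinearMap.id : SuperOp X X)) .zero ?_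
  let F : OutcomeFamily X (mixedSystems X Y ∅) := OutcomeFamily.ofOps (ι := Unit) fun _ v =>
    mixedOp (K v d) (d v = d v) (decide (v ∈ (∅ : Finset V)))
  have heff := fun v => mixedOp_effect_of_false (K v d) (d v = d v)
    (b := decide (v ∈ (∅ : Finset V))) rfl (by simp)
  refine ⟨fun _ => F, fun _ => ⟨a, isOneWayLocal_ofOps a _ (fun _ v _ => heff v) ?_⟩, fun _ => d,
    fun k ρ => ?_⟩
  · rw [Fintype.sum_unique]
    exact heff a
  · change HasSum (fun j : {_j : Σ _ : Unit, Unit // d = k} => conjMap (partialOp K d ∅ d) ρ)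
      (conjMap (partialOp K d ∅ k) ρ)
    by_cases hk : d = k
    · subst hk
      let _ : Unique {_j : Σ _ : Unit, Unit // d = d} :=
        ⟨⟨⟨⟨(), ()⟩, rfl⟩⟩, fun _ => rfl⟩
      exact hasSum_unique _
    · have : IsEmpty {_j : Σ _ : Unit, Unit // d = k} := ⟨fun j => hk j.2⟩
      rw [partialOp_empty_eq_zero (Ne.symm hk), conjMap_zero]
      exact hasSum_empty

-- The parties act in the order of increasing `t`, and each action is one linked step.
include hdep hK in
theorem exists_isLOCCRounds_partialFamily [Nonempty V] (d : ∀ v, O v) (s : Finset V) :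
    ∃ r, IsLOCCRounds r (partialFamily K d s) := by
  induction s using Finset.induction_on_max_value t with
  | empty => exact ⟨1, isLOCCRounds_partialFamily_empty K d⟩
  | insert a s ha hs ih =>
    obtain ⟨r, hr⟩ := ih
    exact ⟨r + 1, .succ hr (isLinked_partialFamily d hdep hK ha hs)⟩

include hdep hK in
/-- If every party acts once, with an instrument that depends on the outcomes of the parties
before it, then the resulting map is LOCC. -/
theorem isFiniteLOCC_sequential [Nonempty V] (d : ∀ v, O v) :
    IsFiniteLOCC (∑ o, conjMap (tensorOp fun v => K v o)) := by
  obtain ⟨r, hr⟩ := exists_isLOCCRounds_partialFamily hdep hK d Finset.univ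
  have h1 : ∑ o : ∀ v, O v, conjMap (tensorOp fun v => K v o) = ∑ o : ∀ v, O v,
      conjMap (tensorOp (X := mixedSystems X Y Finset.univ) (Y := Y)
        fun v => mixedFinish (decide (v ∈ Finset.univ))) ∘ₗ
        (partialFamily K d Finset.univ).map o := by
    refine Finset.sum_congr rfl fun o _ => ?_
    refine Eq.trans ?_ (conjMap_comp _ (partialOp K d Finset.univ o)).symm
    rw [partialOp]
    refine congrArg _ (Eq.trans ?_ (tensorOp_mul _ _).symm)
    congr 1
    funext v
    exact (mixedFinish_mul_mixedOp (K v o) _ (by simp)).symm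
  rw [h1]
  exact ⟨r + 1, .succ hr (isLinked_single_sum_comp (Z := Y) _ _
    fun v => mixedFinish_effect (by simp))⟩

-- Completeness of the whole instrument at the level of operators. It is needed later to show that
-- the failure outcomes vanish on the resource state.
include hdep hK in
theorem sum_partialOp_effect [Nonempty V] (d : ∀ v, O v) (s : Finset V) :
    ∑ o, (partialOp K d s o)ᴴ * partialOp K d s o = 1 := by
  induction s using Finset.induction_on_max_value t with
  | empty =>
    rw [Finset.sum_eq_single d (fun o _ ho => by rw [partialOp_empty_eq_zero ho]; simp) (by simp)]
    unfold partialOp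
    have := sum_tensorOp_effect (X := X) (Y := mixedSystems X Y ∅) (ι := Unit)
      (Classical.arbitrary V) (fun _ v => mixedOp (K v d) (d v = d v) (decide (v ∈ (∅ : Finset V))))
      (fun _ v _ => mixedOp_effect_of_false _ _ rfl (by simp))
      (by rw [Fintype.sum_unique]; exact mixedOp_effect_of_false _ _ rfl (by simp))
    rw [Fintype.sum_unique] at this
    exact this
  | insert a s ha hs ih =>
    rw [sum_eq_sum_update a (d a)]
    have h : ∀ o i, (if o a = d a then (partialOp K d (insert a s) (Function.update o a i))ᴴ *
        partialOp K d (insert a s) (Function.update o a i) else 0)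
        = (partialOp K d s o)ᴴ * ((stepOp K s a (Function.update o a i))ᴴ *
          stepOp K s a (Function.update o a i)) * partialOp K d s o := by
      intro o i
      have h1 := stepOp_mul_partialOp hdep ha hs (d := d) o i
      rw [← Matrix.mul_assoc, Matrix.mul_assoc, h1, ← Matrix.conjTranspose_mul, h1]
      split_ifs <;> simp
    simp only [h, ← Matrix.sum_mul, ← Matrix.mul_sum]
    have h2 : ∀ o : ∀ v, O v, ∑ i, (stepOp K s a (Function.update o a i))ᴴ *
        stepOp K s a (Function.update o a i) = 1 := by
      intro o
      refine sum_tensorOp_effect (X := mixedSystems X Y s) (Y := mixedSystems X Y (insert a s)) a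
        (fun (i : O a) v => mixedStep (K v (Function.update o a i)) (decide (v ∈ s))
          (decide (v ∈ insert a s))) ?_ ?_
      · intro i v hv
        exact mixedStep_effect_of_eq _ (by simp [hv])
      · exact mixedStep_effect_of_act (fun i : O a => K a (Function.update o a i)) (hK a o)
          (b := decide (a ∈ s)) (b' := decide (a ∈ insert a s)) (by simpa using ha) (by simp)
    simp only [h2, Matrix.mul_one]
    exact ih

include hdep hK in
theorem sum_sequential_effect [Nonempty V] (d : ∀ v, O v) :
    ∑ o, (tensorOp fun v => K v o)ᴴ * (tensorOp fun v => K v o) = 1 := by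
  rw [← sum_partialOp_effect hdep hK d Finset.univ]
  refine Finset.sum_congr rfl fun o _ => ?_
  have h1 : (tensorOp fun v => K v o) = tensorOp (X := mixedSystems X Y Finset.univ) (Y := Y)
        (fun v => mixedFinish (decide (v ∈ Finset.univ))) * partialOp K d Finset.univ o := by
    rw [partialOp]
    refine (Eq.trans ?_ (tensorOp_mul _ _).symm)
    congr 1
    funext v
    exact (mixedFinish_mul_mixedOp (K v o) _ (by simp)).symm
  have h2 := sum_tensorOp_effect (ι := Unit) (X := mixedSystems X Y Finset.univ) (Y := Y)
    (Classical.arbitrary V) (fun _ v => mixedFinish (decide (v ∈ Finset.univ)))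
    (fun _ v _ => mixedFinish_effect (by simp))
    (by rw [Fintype.sum_unique]; exact mixedFinish_effect (by simp))
  rw [Fintype.sum_unique] at h2
  rw [h1, Matrix.conjTranspose_mul, Matrix.mul_assoc, ← Matrix.mul_assoc _ _ (partialOp K d _ o), h2,
    Matrix.one_mul]

end Sequential

/-! ## Schmidt number cones -/

section SchmidtCone

variable {V : Type} [Fintype V] [DecidableEq V] {R : Type}
  {X Y Z : LocalSystems V} (A : Finset V) (k : ℕ)

/-- The vector `ψ` of `ℂ^R ⊗ ⨂ v, ℂ^(X.Idx v)` is a sum of `k` product vectors with respect to the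
bipartition into the parties in `A` and the rest, to which the reference system `R` belongs. -/
def HasSchmidtForm (ψ : R × X.Joint → ℂ) : Prop :=
  ∃ (f : Fin k → (∀ v : {v // v ∈ A}, X.Idx v) → ℂ)
    (g : Fin k → R → (∀ v : {v // v ∉ A}, X.Idx v) → ℂ),
    ∀ r x, ψ (r, x) = ∑ i, f i (fun v => x v) * g i r (fun v => x v)

theorem HasSchmidtForm.of_dependsOn {ψ : R × X.Joint → ℂ} (f : Fin k → X.Joint → ℂ)
    (g : Fin k → R → X.Joint → ℂ) (hf : ∀ i, DependsOn (f i) (A : Set V))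
    (hg : ∀ i r, DependsOn (g i r) (A : Set V)ᶜ)
    (h : ∀ r x, ψ (r, x) = ∑ i, f i x * g i r x) : HasSchmidtForm A k ψ := by
  rcases isEmpty_or_nonempty X.Joint with he | ⟨⟨x0⟩⟩
  · exact ⟨0, 0, fun _ x => he.elim x⟩
  -- The coordinates on the other side of the cut do not matter and are filled with those of an
  -- arbitrary label `x0`.
  · refine ⟨fun i a => f i fun v => if h : v ∈ A then a ⟨v, h⟩ else x0 v,
      fun i r a => g i r fun v => if h : v ∈ A then x0 v else a ⟨v, h⟩, fun r x => ?_⟩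
    rw [h]
    refine Finset.sum_congr rfl fun i _ => ?_
    congr 1
    · exact hf i fun v hv => by simp [Finset.mem_coe.1 hv]
    · exact hg i r fun v hv => by
        have : v ∉ A := fun h => hv (Finset.mem_coe.2 h)
        simp [this]

/-- The operator `1 ⊗ K` applied to a vector. -/
def extendVec (K : Matrix Y.Joint X.Joint ℂ) (ψ : R × X.Joint → ℂ) : R × Y.Joint → ℂ :=
  fun p => ∑ x, K p.2 x * ψ (p.1, x)

variable {A k}

/-- A product operator factors across the cut, so each product term is mapped to a single product
term. -/
theorem HasSchmidtForm.extendVec_tensorOp {ψ : R × X.Joint → ℂ} (h : HasSchmidtForm A k ψ)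
    (K : ∀ v, Matrix (Y.Idx v) (X.Idx v) ℂ) :
    HasSchmidtForm A k (extendVec (tensorOp K) ψ) := by
  obtain ⟨f, g, h⟩ := h
  refine ⟨fun i b => ∑ a : (∀ v : {v // v ∈ A}, X.Idx v), (∏ v : {v // v ∈ A}, K v (b v) (a v)) * f i a,
    fun i r b => ∑ a : (∀ v : {v // v ∉ A}, X.Idx v), (∏ v : {v // v ∉ A}, K v (b v) (a v)) * g i r a,
    fun r y => ?_⟩
  simp only [extendVec, tensorOp, Matrix.of_apply, h, Finset.mul_sum]
  rw [Finset.sum_comm]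
  refine Finset.sum_congr rfl fun i _ => ?_
  rw [← Finset.mul_sum, Finset.sum_mul_sum, ← Fintype.sum_prod_type']
  refine Fintype.sum_equiv (Equiv.piEquivPiSubtypeProd (fun v => v ∈ A) X.Idx) _ _ fun x => ?_
  simp only [Equiv.piEquivPiSubtypeProd_apply]
  rw [← Fintype.prod_subtype_mul_prod_subtype (fun v => v ∈ A), mul_mul_mul_comm]
  congr!

/-- The map `id ⊗ S`, where the identity acts on operators of the reference system. -/
def extendMap (S : SuperOp X Y) (σ : Matrix (R × X.Joint) (R × X.Joint) ℂ) :
    Matrix (R × Y.Joint) (R × Y.Joint) ℂ :=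
  Matrix.of fun p q => S (Matrix.of fun x x' => σ (p.1, x) (q.1, x')) p.2 q.2

theorem extendMap_comp (S : SuperOp Y Z) (T : SuperOp X Y)
    (σ : Matrix (R × X.Joint) (R × X.Joint) ℂ) :
    extendMap (S ∘ₗ T) σ = extendMap S (extendMap T σ) := rfl

theorem extendMap_add (S : SuperOp X Y) (σ τ : Matrix (R × X.Joint) (R × X.Joint) ℂ) :
    extendMap S (σ + τ) = extendMap S σ + extendMap S τ := by
  ext p q
  simp only [extendMap, Matrix.of_apply, Matrix.add_apply]
  rw [← Matrix.add_apply, ← map_add]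
  rfl

theorem extendMap_zero (S : SuperOp X Y) :
    extendMap S (0 : Matrix (R × X.Joint) (R × X.Joint) ℂ) = 0 := by
  ext p q
  change S 0 p.2 q.2 = 0
  simp

theorem continuous_extendMap (S : SuperOp X Y) :
    Continuous (extendMap (R := R) S) := by
  refine continuous_matrix fun p q => ?_
  have h1 : Continuous (fun σ : Matrix (R × X.Joint) (R × X.Joint) ℂ =>
      (Matrix.of fun x x' => σ (p.1, x) (q.1, x') : Op X)) :=
    continuous_matrix fun x x' => continuous_id.matrix_elem _ _
  have h2 : Continuous S := S.continuous_of_finiteDimensional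
  exact (h2.comp h1).matrix_elem p.2 q.2

theorem extendMap_conjMap (K : Matrix Y.Joint X.Joint ℂ) (ψ : R × X.Joint → ℂ) :
    extendMap (conjMap K) (vecMulVec ψ (star ψ))
      = vecMulVec (extendVec K ψ) (star (extendVec K ψ)) := by
  ext p q
  simp only [extendMap, conjMap_apply, Matrix.of_apply, Matrix.mul_apply, vecMulVec_apply,
    extendVec, Pi.star_apply, Matrix.conjTranspose_apply, star_sum, star_mul', Finset.sum_mul_sum]
  simp only [Finset.sum_mul]
  rw [Finset.sum_comm]
  refine Finset.sum_congr rfl fun x _ => Finset.sum_congr rfl fun x' _ => ?_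
  ring

variable (R X A k) in
/-- The closed convex cone of the operators of Schmidt number at most `k`. -/
def schmidtCone : AddSubmonoid (Matrix (R × X.Joint) (R × X.Joint) ℂ) :=
  (AddSubmonoid.closure
    {σ | ∃ ψ, HasSchmidtForm A k ψ ∧ σ = vecMulVec ψ (star ψ)}).topologicalClosure

theorem isClosed_schmidtCone :
    IsClosed (schmidtCone R X A k : Set (Matrix (R × X.Joint) (R × X.Joint) ℂ)) :=
  AddSubmonoid.isClosed_topologicalClosure _

theorem vecMulVec_mem_schmidtCone {ψ : R × X.Joint → ℂ} (h : HasSchmidtForm A k ψ) :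
    vecMulVec ψ (star ψ) ∈ schmidtCone R X A k :=
  AddSubmonoid.le_topologicalClosure _ (AddSubmonoid.subset_closure ⟨ψ, h, rfl⟩)

variable (R A k) in
/-- The map `id ⊗ S` does not increase the Schmidt number. -/
def PreservesSchmidt (S : SuperOp X Y) : Prop :=
  ∀ σ ∈ schmidtCone R X A k, extendMap S σ ∈ schmidtCone R Y A k

/-- Generators go to generators; additivity and continuity of `extendMap` carry this over to the
closed cone. -/
theorem preservesSchmidt_conjMap (K : ∀ v, Matrix (Y.Idx v) (X.Idx v) ℂ) :
    PreservesSchmidt R A k (conjMap (tensorOp K)) := by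
  intro σ hσ
  refine map_mem_closure (continuous_extendMap _) hσ fun τ hτ => ?_
  induction hτ using AddSubmonoid.closure_induction with
  | mem τ hτ =>
    obtain ⟨ψ, hψ, rfl⟩ := hτ
    rw [extendMap_conjMap]
    exact AddSubmonoid.subset_closure ⟨_, hψ.extendVec_tensorOp K, rfl⟩
  | zero =>
    rw [extendMap_zero]
    exact AddSubmonoid.zero_mem _
  | add σ τ _ _ hσ hτ =>
    rw [extendMap_add]
    exact AddSubmonoid.add_mem _ hσ hτ

theorem PreservesSchmidt.comp {S : SuperOp Y Z} {T : SuperOp X Y} (hS : PreservesSchmidt R A k S)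
    (hT : PreservesSchmidt R A k T) : PreservesSchmidt R A k (S ∘ₗ T) := fun σ hσ => by
  rw [extendMap_comp]
  exact hS _ (hT _ hσ)

theorem PreservesSchmidt.sum {ι : Type*} (s : Finset ι) (S : ι → SuperOp X Y)
    (h : ∀ i, PreservesSchmidt R A k (S i)) : PreservesSchmidt R A k (∑ i ∈ s, S i) := by
  intro σ hσ
  have : extendMap (∑ i ∈ s, S i) σ = ∑ i ∈ s, extendMap (S i) σ := by
    ext p q
    simp [extendMap, Matrix.sum_apply, LinearMap.sum_apply]
  rw [this]
  exact AddSubmonoid.sum_mem _ fun i _ => h i σ hσ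

theorem PreservesSchmidt.of_tendsto {ι : Type*} {l : Filter ι} [l.NeBot] {T : ι → SuperOp X Y}
    {S : SuperOp X Y} (hT : ∀ i, PreservesSchmidt R A k (T i))
    (h : ∀ ρ, Tendsto (fun i => T i ρ) l (𝓝 (S ρ))) : PreservesSchmidt R A k S := by
  intro σ hσ
  refine isClosed_schmidtCone.mem_of_tendsto (f := fun i => extendMap (T i) σ) (b := l) ?_
    (Eventually.of_forall fun i => hT i σ hσ)
  refine tendsto_pi_nhds.2 fun p => tendsto_pi_nhds.2 fun q => ?_
  exact tendsto_pi_nhds.1 (tendsto_pi_nhds.1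
    (h (Matrix.of fun x x' => σ (p.1, x) (q.1, x'))) p.2) q.2

theorem PreservesSchmidt.of_hasSum {ι : Type*} {T : ι → SuperOp X Y} {S : SuperOp X Y}
    (hT : ∀ i, PreservesSchmidt R A k (T i)) (h : ∀ ρ, HasSum (fun i => T i ρ) (S ρ)) :
    PreservesSchmidt R A k S := by
  refine PreservesSchmidt.of_tendsto (l := (atTop : Filter (Finset ι)))
    (T := fun s => ∑ i ∈ s, T i) (fun s => .sum s T hT) fun ρ => ?_
  simpa only [LinearMap.sum_apply, HasSum, SummationFilter.unconditional_filter] using h ρ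

/-- Local instruments are finite sums of conjugations by product operators, and forgetting outcomes
is a convergent sum. Trace preservation plays no role. -/
theorem PreservesSchmidt.of_isLinked {J : OutcomeFamily X Y} {J' : OutcomeFamily X Z}
    (hJ : ∀ j, PreservesSchmidt R A k (J.map j)) (h : IsLinked J J') (j) :
    PreservesSchmidt R A k (J'.map j) := by
  obtain ⟨F, hF, f, hf⟩ := h
  refine .of_hasSum (fun p => ?_) (hf j)
  obtain ⟨⟨i, a⟩, _⟩ := p
  refine PreservesSchmidt.comp ?_ (hJ i)
  obtain ⟨K, C, hC, _⟩ := hF i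
  rw [hC]
  exact .sum _ _ fun _ => preservesSchmidt_conjMap _

theorem PreservesSchmidt.of_isLOCCRounds {r : ℕ} {J : OutcomeFamily X Y} (h : IsLOCCRounds r J)
    (j) : PreservesSchmidt R A k (J.map j) := by
  induction h with
  | zero => exact fun σ hσ => hσ
  | succ _ hl ih => exact .of_isLinked ih hl j

/-- Every stopped protocol preserves the cone, and closedness of the cone passes this on to the
limit. -/
theorem PreservesSchmidt.of_isLOCC {S : SuperOp X Y} (h : IsLOCC S) : PreservesSchmidt R A k S := by
  obtain ⟨Z, J, T, ⟨r, hr⟩, hJ, hT, hlim⟩ := h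
  have h1 : ∀ n j, PreservesSchmidt R A k ((J n).map j) := by
    intro n
    induction n with
    | zero => exact fun j => .of_isLOCCRounds hr j
    | succ n ih => exact fun j => .of_isLinked ih (hJ n) j
  exact .of_tendsto (fun n => .of_isLinked (h1 n) (hT n) ()) hlim

end SchmidtCone

/-! ### Rank-one operators in the Schmidt number cone -/

section Witness

/-- A vector outside a closed cone has overlap with the unit vectors of the cone bounded away from
its norm. -/
theorem exists_overlap_bound {E : Type*} [NormedAddCommGroup E] [InnerProductSpace ℂ E]
    [FiniteDimensional ℂ E] {C : Set E} (hC : IsClosed C)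
    (hsmul : ∀ (a : ℂ) (x : E), x ∈ C → a • x ∈ C) {φ : E} (hφ : φ ∉ C) :
    ∃ c : ℝ, c < ‖φ‖ ∧ ∀ x ∈ C, ‖inner ℂ φ x‖ ≤ c * ‖x‖ := by
  have : ProperSpace E := FiniteDimensional.proper ℂ E
  have hcomp : IsCompact (C ∩ Metric.sphere 0 1) := (isCompact_sphere 0 1).inter_left hC
  -- The overlap attains its maximum on the compact set of unit vectors of `C`. If the maximum were
  -- `‖φ‖`, equality in the Cauchy–Schwarz inequality would make `φ` a multiple of a vector of `C`.
  have key : ∃ c : ℝ, c < ‖φ‖ ∧ ∀ x ∈ C, ‖x‖ = 1 → ‖inner ℂ φ x‖ ≤ c := by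
    rcases (C ∩ Metric.sphere 0 1).eq_empty_or_nonempty with he | hne
    · refine ⟨‖φ‖ - 1, by linarith, fun x hx hx1 => ?_⟩
      have : x ∈ C ∩ Metric.sphere (0 : E) 1 := ⟨hx, by simpa using hx1⟩
      rw [he] at this
      exact this.elim
    · obtain ⟨x0, ⟨hx0, hx01⟩, hmax⟩ := hcomp.exists_isMaxOn hne
        (f := fun x => ‖inner ℂ φ x‖) (by fun_prop)
      refine ⟨_, ?_, fun x hx hx1 => hmax ⟨hx, by simpa using hx1⟩⟩
      have hx1 : ‖x0‖ = 1 := by simpa using hx01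
      have hle : ‖inner ℂ φ x0‖ ≤ ‖φ‖ := by
        have := norm_inner_le_norm (𝕜 := ℂ) φ x0
        rwa [hx1, mul_one] at this
      refine lt_of_le_of_ne hle fun heq => hφ ?_
      have hx0n : x0 ≠ 0 := by
        rintro rfl
        simp at hx1
      by_cases hφ0 : φ = 0
      · rw [hφ0]
        simpa using hsmul 0 x0 hx0
      · have h2 := (norm_inner_eq_norm_iff (𝕜 := ℂ) hφ0 hx0n).1 (by rw [hx1, mul_one]; exact heq)
        obtain ⟨r, hr, h3⟩ := h2
        have : φ = r⁻¹ • x0 := by rw [h3, smul_smul, inv_mul_cancel₀ hr, one_smul]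
        rw [this]
        exact hsmul _ _ hx0
  obtain ⟨c, hc, h⟩ := key
  refine ⟨c, hc, fun x hx => ?_⟩
  by_cases hx0 : x = 0
  · simp [hx0]
  · have hn : 0 < ‖x‖ := norm_pos_iff.2 hx0
    have h1 := h (((‖x‖⁻¹ : ℝ) : ℂ) • x) (hsmul _ _ hx) (by
      rw [norm_smul, Complex.norm_real, norm_inv, norm_norm, inv_mul_cancel₀ hn.ne'])
    rw [inner_smul_right, norm_mul, Complex.norm_real, norm_inv, norm_norm] at h1
    rwa [inv_mul_le_iff₀ hn, mul_comm] at h1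

/-- Lower semicontinuity of the rank: the condition that the rank is at least `k + 1` is open. -/
theorem isClosed_setOf_rank_le {m n : Type*} [Fintype m] [Fintype n] (k : ℕ) :
    IsClosed {B : Matrix m n ℂ | B.rank ≤ k} := by
  classical
  let L : Matrix m n ℂ →ₗ[ℂ] ((n → ℂ) →L[ℂ] (m → ℂ)) :=
    (LinearMap.toContinuousLinearMap.toLinearMap).comp (Matrix.toLin' (R := ℂ)).toLinearMap
  have hL : Continuous L := L.continuous_of_finiteDimensional
  have h1 := (isOpen_setOfPred_nat_le_rank (𝕜 := ℂ) (E := n → ℂ) (F := m → ℂ)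
    (k + 1)).preimage hL
  rw [← isOpen_compl_iff]
  convert h1 using 1
  ext B
  simp only [Set.mem_compl_iff, Set.mem_ofPred_eq, not_le, Set.mem_preimage]
  have h2 : LinearMap.rank ((L B : (n → ℂ) →L[ℂ] (m → ℂ)) : (n → ℂ) →ₗ[ℂ] (m → ℂ)) = (B.rank : Cardinal) := by
    rw [Matrix.rank, LinearMap.rank]
    exact (Module.finrank_eq_rank _ _).symm
  rw [h2]
  norm_cast

variable {V : Type} [Fintype V] [DecidableEq V] {R : Type} [Fintype R] [DecidableEq R]
  {X : LocalSystems V} {A : Finset V} {k : ℕ}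

/-- The coefficient matrix of a vector with respect to a bipartition, the reference system
belonging to the second part. -/
def coeffMatrix (A : Finset V) (ψ : R × X.Joint → ℂ) :
    Matrix (∀ v : {v // v ∈ A}, X.Idx v) (R × ∀ v : {v // v ∉ A}, X.Idx v) ℂ :=
  Matrix.of fun a q => ψ (q.1, (Equiv.piEquivPiSubtypeProd (fun v => v ∈ A) X.Idx).symm (a, q.2))

theorem HasSchmidtForm.rank_le {ψ : R × X.Joint → ℂ} (h : HasSchmidtForm A k ψ) :
    (coeffMatrix A ψ).rank ≤ k := by
  obtain ⟨f, g, h⟩ := h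
  have h1 : coeffMatrix A ψ = (Matrix.of fun a i => f i a : Matrix _ (Fin k) ℂ) *
      (Matrix.of fun i q => g i q.1 q.2) := by
    ext a q
    simp only [coeffMatrix, Matrix.of_apply, Matrix.mul_apply, h]
    refine Finset.sum_congr rfl fun i _ => ?_
    congr 2
    · funext v
      simp [Equiv.piEquivPiSubtypeProd, v.2]
    · funext v
      simp [Equiv.piEquivPiSubtypeProd, v.2]
  rw [h1]
  refine (Matrix.rank_mul_le_left _ _).trans ((Matrix.rank_le_card_width _).trans ?_)
  simp

theorem rank_smul_le {m n : Type*} [Fintype m] [Fintype n] (a : ℂ) (B : Matrix m n ℂ) :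
    (a • B).rank ≤ B.rank := by
  classical
  have : a • B = B * (a • (1 : Matrix n n ℂ)) := by simp
  rw [this]
  exact Matrix.rank_mul_le_left _ _

/-- A pure state in the Schmidt number cone has Schmidt rank at most `k`. -/
theorem rank_le_of_vecMulVec_mem_schmidtCone {φ : R × X.Joint → ℂ}
    (h : vecMulVec φ (star φ) ∈ schmidtCone R X A k) : (coeffMatrix A φ).rank ≤ k := by
  by_contra hr
  let C : Set (EuclideanSpace ℂ (R × X.Joint)) := {ψ | (coeffMatrix A ψ.ofLp).rank ≤ k}
  have hC : IsClosed C := by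
    refine (isClosed_setOf_rank_le k).preimage (f := fun ψ : EuclideanSpace ℂ (R × X.Joint) =>
      coeffMatrix A ψ.ofLp) ?_
    refine continuous_matrix fun a q => ?_
    simp only [coeffMatrix, Matrix.of_apply]
    fun_prop
  have hs : ∀ (a : ℂ) (x : EuclideanSpace ℂ (R × X.Joint)), x ∈ C → a • x ∈ C := by
    intro a x hx
    exact (rank_smul_le a (coeffMatrix A x.ofLp)).trans hx
  set N := ‖WithLp.toLp 2 φ‖ with hN
  have hN0 : 0 < N := by
    rw [hN, norm_pos_iff]
    intro h0
    apply hr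
    have : φ = 0 := by simpa using h0
    have h1 : coeffMatrix A φ = 0 := by
      rw [this]
      rfl
    rw [h1, Matrix.rank_zero]
    exact Nat.zero_le k
  obtain ⟨c, hc0, hc, hb⟩ : ∃ c : ℝ, 0 ≤ c ∧ c < N ∧
      ∀ x ∈ C, ‖inner ℂ (WithLp.toLp 2 φ) x‖ ≤ c * ‖x‖ := by
    obtain ⟨c, hc, hb⟩ := exists_overlap_bound hC hs (φ := WithLp.toLp 2 φ) hr
    -- The bound is made nonnegative so that it can be squared.
    exact ⟨max c 0, le_max_right _ _, max_lt hc hN0, fun x hx => (hb x hx).trans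
      (mul_le_mul_of_nonneg_right (le_max_left _ _) (norm_nonneg _))⟩
  have hinner : ∀ ψ : R × X.Joint → ℂ, inner ℂ (WithLp.toLp 2 φ) (WithLp.toLp 2 ψ)
      = ψ ⬝ᵥ star φ := fun ψ => by rw [EuclideanSpace.inner_toLp_toLp]
  have hnorm : ∀ ψ : R × X.Joint → ℂ, ‖WithLp.toLp 2 ψ‖ ^ 2 = (ψ ⬝ᵥ star ψ).re := fun ψ => by
    rw [← inner_self_eq_norm_sq (𝕜 := ℂ), EuclideanSpace.inner_toLp_toLp]
    rfl
  -- A Schmidt number witness: $\langle\varphi,\sigma\varphi\rangle\le c^2\operatorname{tr}\sigma$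
  -- is a closed linear condition that holds for the generators by the overlap bound. For
  -- $\sigma=|\varphi\rangle\langle\varphi|$ it would read $N^4\le c^2N^2$, which contradicts $c<N$.
  let W : Set (Matrix (R × X.Joint) (R × X.Joint) ℂ) :=
    {σ | (star φ ⬝ᵥ σ *ᵥ φ).re ≤ c ^ 2 * σ.trace.re}
  have hmem : ∀ σ, σ ∈ W ↔ (star φ ⬝ᵥ σ *ᵥ φ).re ≤ c ^ 2 * σ.trace.re := fun _ => Iff.rfl
  have hW : IsClosed W := by
    refine isClosed_le ?_ ?_
    · fun_prop
    · fun_prop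
  have hval : ∀ ψ : R × X.Joint → ℂ, (star φ ⬝ᵥ (vecMulVec ψ (star ψ)) *ᵥ φ).re
      = ‖ψ ⬝ᵥ star φ‖ ^ 2 := by
    intro ψ
    have h1 : star ψ ⬝ᵥ φ = star (ψ ⬝ᵥ star φ) := by
      rw [Matrix.star_dotProduct, dotProduct_comm]
    rw [Matrix.vecMulVec_mulVec, dotProduct_smul, dotProduct_comm (star φ) ψ, h1]
    simp [Complex.mul_conj, Complex.normSq_eq_norm_sq, -Complex.ofReal_pow]
  have htr : ∀ ψ : R × X.Joint → ℂ, (vecMulVec ψ (star ψ)).trace.re = ‖WithLp.toLp 2 ψ‖ ^ 2 := by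
    intro ψ
    rw [hnorm, Matrix.trace_vecMulVec]
  have hsub : (schmidtCone R X A k : Set (Matrix (R × X.Joint) (R × X.Joint) ℂ)) ⊆ W := by
    refine closure_minimal (fun σ hσ => ?_) hW
    induction hσ using AddSubmonoid.closure_induction with
    | mem τ hτ =>
      obtain ⟨ψ, hψ, rfl⟩ := hτ
      have h1 := hb (WithLp.toLp 2 ψ) hψ.rank_le
      rw [hinner] at h1
      rw [hmem, hval, htr, ← mul_pow]
      exact pow_le_pow_left₀ (norm_nonneg _) h1 2
    | zero => simp [hmem]
    | add σ τ _ _ hσ hτ =>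
      simp only [hmem, Matrix.add_mulVec, dotProduct_add, Complex.add_re,
        Matrix.trace_add] at hσ hτ ⊢
      linarith
  have h1 := (hmem _).1 (hsub h)
  rw [hval, htr, ← hinner, inner_self_eq_norm_sq_to_K] at h1
  simp only [norm_pow, Complex.coe_algebraMap, Complex.norm_real, ← hN, Real.norm_eq_abs,
    sq_abs] at h1
  have h2 : c ^ 2 < N ^ 2 := pow_lt_pow_left₀ hc hc0 two_ne_zero
  have h3 : 0 < N ^ 2 := by positivity
  nlinarith [mul_pos (sub_pos.2 h2) h3]

end Witness

/-! ### Schmidt rank of the resource state across an edge -/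

section Resource

variable {V : Type} [Fintype V] [DecidableEq V] {T : SimpleGraph V} [DecidableRel T.Adj]
  (hT : T.IsTree) (root : V) {D : ℕ} (M : T.edgeSet → ℕ)

theorem parent_mem_parentEdge {v : V} (hv : v ≠ root) :
    parent hT root v ∈ (parentEdge hT root v hv : Sym2 V) := Sym2.mem_mk_left _ _

theorem mem_parentEdge {v : V} (hv : v ≠ root) :
    v ∈ (parentEdge hT root v hv : Sym2 V) := Sym2.mem_mk_right _ _

/-- The factor of the resource vector that belongs to the edge above a vertex. -/
def edgeFactor (w : {w : V // w ≠ root}) (x : (inputSystems T root D M).Joint) : ℂ :=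
  if (x (parent hT root w)).2 (parentEdge hT root w w.2) (parent_mem_parentEdge hT root w.2)
    = (x w).2 (parentEdge hT root w w.2) (mem_parentEdge hT root w.2)
  then (((1 / Real.sqrt (M (parentEdge hT root w w.2)) : ℝ)) : ℂ) else 0

/-- Edges are indexed by their lower endpoints, and agreement of all endpoints of an edge is the
single equation between parent and child. -/
theorem resourceVec_eq_prod (x : (inputSystems T root D M).Joint) :
    resourceVec T root D M x = ∏ w : {w : V // w ≠ root}, edgeFactor hT root M w x := by
  unfold resourceVec
  rw [← (parentEdgeEquiv hT root).prod_comp]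
  refine Finset.prod_congr rfl fun w _ => ?_
  change (if ∀ (a b : V) (ha : a ∈ (parentEdge hT root w w.2 : Sym2 V))
    (hb : b ∈ (parentEdge hT root w w.2 : Sym2 V)), (x a).2 (parentEdge hT root w w.2) ha
      = (x b).2 (parentEdge hT root w w.2) hb then
      (((1 / Real.sqrt (M (parentEdge hT root w w.2)) : ℝ)) : ℂ) else 0) = _
  unfold edgeFactor
  refine if_congr ⟨fun h => h _ _ _ _, fun h a b ha hb => ?_⟩ rfl rfl
  have h1 : ∀ a, a ∈ (parentEdge hT root w w.2 : Sym2 V) → a = parent hT root w ∨ a = w :=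
    fun a ha => Sym2.mem_iff.1 ha
  rcases h1 a ha with rfl | rfl <;> rcases h1 b hb with rfl | rfl
  · rfl
  · exact h
  · exact h.symm
  · rfl

/-- The vector `∑ l, |l⟩ ⊗ |l⟩ ⊗ |resource⟩`, whose first factor is the reference system. -/
def referenceVec (p : Fin D × (inputSystems T root D M).Joint) : ℂ :=
  if (p.2 root).1 rfl = p.1 then resourceVec T root D M p.2 else 0

theorem edgeFactor_dependsOn (w : {w : V // w ≠ root}) {s : Set V} (hw : (w : V) ∈ s)
    (hp : parent hT root w ∈ s) :
    DependsOn (edgeFactor (D := D) hT root M w) s := by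
  intro x y h
  simp only [edgeFactor, h _ hw, h _ hp]

/-- The edge above `v` is the only one that crosses the cut, and its factor is a sum of $M_e$
product terms. All other edges, and the link between the reference and the root, lie on one side. -/
theorem hasSchmidtForm_referenceVec {v : V} (hv : v ≠ root) :
    HasSchmidtForm (X := inputSystems T root D M) (subtreeAt T root v)
      (M (parentEdge hT root v hv)) (referenceVec (D := D) root M) := by
  set A := subtreeAt T root v with hA
  let R := rootedTree hT root
  have hmem : ∀ w, w ∈ A ↔ w = v ∨ (w ≠ root ∧ parent hT root w ∈ A) := fun w => R.mem_subtree v w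
  have hroot : root ∉ A := R.root_notMem_subtree hv
  have hvA : v ∈ A := R.self_mem_subtree v
  have hpar : parent hT root v ∉ A := fun h => by
    have h1 := R.depth_le_of_mem_subtree h
    have h2 := R.depth_par_lt v hv
    have h3 : R.par v = parent hT root v := rfl
    rw [h3] at h2
    omega
  let e := parentEdge hT root v hv
  refine HasSchmidtForm.of_dependsOn _ _
    (fun i x => (if (x v).2 e (mem_parentEdge hT root hv) = i then 1 else 0) *
      ∏ w : {w : V // w ≠ root}, if (w : V) ∈ A ∧ (w : V) ≠ v then edgeFactor hT root M w x else 1)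
    (fun i l x => (if (x root).1 rfl = l then 1 else 0) *
      ((if (x (parent hT root v)).2 e (parent_mem_parentEdge hT root hv) = i then 1 else 0) *
      (((1 / Real.sqrt (M e) : ℝ)) : ℂ) *
      ∏ w : {w : V // w ≠ root}, if (w : V) ∉ A then edgeFactor hT root M w x else 1)) ?_ ?_ ?_
  · intro i x y h
    simp only [h v hvA]
    congr 1
    refine Finset.prod_congr rfl fun w _ => ?_
    split_ifs with hw
    · refine edgeFactor_dependsOn hT root M w (s := (A : Set V)) hw.1 ?_ h
      rcases (hmem w).1 hw.1 with h1 | h1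
      · exact absurd h1 hw.2
      · exact h1.2
    · rfl
  · intro i l x y h
    have h1 := h root hroot
    have h2 := h _ hpar
    simp only [h1, h2]
    congr 2
    refine Finset.prod_congr rfl fun w _ => ?_
    split_ifs with hw
    · rfl
    · refine edgeFactor_dependsOn hT root M w (s := (A : Set V)ᶜ) hw ?_ h
      exact fun hp => hw ((hmem w).2 (Or.inr ⟨w.2, hp⟩))
  · intro l x
    have h1 : referenceVec root M (l, x) = (if (x root).1 rfl = l then 1 else 0) *
        ∏ w : {w : V // w ≠ root}, edgeFactor hT root M w x := by
      simp only [referenceVec, resourceVec_eq_prod hT]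
      split_ifs <;> simp
    -- The edges are sorted into the crossing one, those inside the subtree and those outside.
    have h2 : ∏ w : {w : V // w ≠ root}, edgeFactor hT root M w x =
        (∏ w : {w : V // w ≠ root}, if w = ⟨v, hv⟩ then edgeFactor hT root M w x else 1) *
        ((∏ w : {w : V // w ≠ root}, if (w : V) ∈ A ∧ (w : V) ≠ v then edgeFactor hT root M w x
          else 1) *
        ∏ w : {w : V // w ≠ root}, if (w : V) ∉ A then edgeFactor hT root M w x else 1) := by
      rw [← Finset.prod_mul_distrib, ← Finset.prod_mul_distrib]
      refine Finset.prod_congr rfl fun w _ => ?_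
      by_cases hwv : w = ⟨v, hv⟩
      · subst hwv
        simp [hvA]
      · have hwv' : (w : V) ≠ v := fun h => hwv (Subtype.ext h)
        by_cases hwA : (w : V) ∈ A <;> simp [hwv, hwv', hwA]
    rw [h1, h2]
    rw [Finset.prod_ite_eq' Finset.univ (⟨v, hv⟩ : {w : V // w ≠ root}), if_pos (Finset.mem_univ _)]
    have h3 : edgeFactor hT root M ⟨v, hv⟩ x = ∑ i : Fin (M e),
        (if (x v).2 e (mem_parentEdge hT root hv) = i then (1 : ℂ) else 0) *
        ((if (x (parent hT root v)).2 e (parent_mem_parentEdge hT root hv) = i then 1 else 0) *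
      (((1 / Real.sqrt (M e) : ℝ)) : ℂ)) := by
      simp only [edgeFactor, ite_mul, one_mul, zero_mul, Finset.sum_ite_eq, Finset.mem_univ,
        if_true]
      rfl
    rw [h3, Finset.sum_mul, Finset.mul_sum]
    refine Finset.sum_congr rfl fun i _ => ?_
    ring

end Resource

/-! ### Necessity of the rank bound -/

section Necessity

variable {V : Type} [Fintype V] [DecidableEq V] {T : SimpleGraph V} [DecidableRel T.Adj]
  {root : V} {D : ℕ} {d : V → ℕ}

/-- A linear map on matrices that vanishes on the density operators is zero. -/
theorem eq_zero_of_forall_isDensity {n : Type} [Fintype n] [DecidableEq n] {W : Type*}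
    [AddCommGroup W] [Module ℂ W] (L : Matrix n n ℂ →ₗ[ℂ] W) (h : ∀ ρ, IsDensity ρ → L ρ = 0) :
    L = 0 := by
  have h1 : ∀ u : n → ℂ, L (vecMulVec u (star u)) = 0 := by
    intro u
    by_cases hu : u = 0
    · simp [hu]
    · have hpos : 0 < u ⬝ᵥ star u := by
        rw [dotProduct_comm]
        exact Matrix.dotProduct_star_self_pos_iff.2 hu
      have h2 := h ((u ⬝ᵥ star u)⁻¹ • vecMulVec u (star u))
        ⟨(Matrix.posSemidef_vecMulVec_self_star u).smul (inv_nonneg.2 hpos.le), by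
          rw [Matrix.trace_smul, Matrix.trace_vecMulVec, smul_eq_mul, inv_mul_cancel₀ hpos.ne']⟩
      rw [map_smul] at h2
      exact (smul_eq_zero.1 h2).resolve_left (inv_ne_zero hpos.ne')
  -- Polarization: expand at `u + w`, and below replace `u` by `I • u` to separate the two terms.
  have h2 : ∀ u w : n → ℂ, L (vecMulVec u (star w)) + L (vecMulVec w (star u)) = 0 := by
    intro u w
    have := h1 (u + w)
    rw [star_add, Matrix.add_vecMulVec, Matrix.vecMulVec_add, Matrix.vecMulVec_add, map_add,
      map_add, map_add, h1, h1, zero_add, add_zero] at this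
    exact this
  have h3 : ∀ u w : n → ℂ, L (vecMulVec u (star w)) = 0 := by
    intro u w
    have e1 := h2 u w
    have e2 := h2 (Complex.I • u) w
    rw [star_smul, Matrix.vecMulVec_smul, Matrix.smul_vecMulVec, map_smul, map_smul] at e2
    have e3 : L (vecMulVec w (star u)) = - L (vecMulVec u (star w)) := by
      rw [eq_neg_iff_add_eq_zero, add_comm]; exact e1
    rw [e3] at e2
    have e4 : (Complex.I + Complex.I) • L (vecMulVec u (star w)) = 0 := by
      rw [← e2]
      simp [add_smul]
    refine (smul_eq_zero.1 e4).resolve_left ?_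
    rw [← two_mul]
    simp
  have h4 : ∀ (i j : n) (a : ℂ), Matrix.single i j a
      = a • vecMulVec (Pi.single i 1) (star (Pi.single j (1 : ℂ))) := by
    intro i j a
    ext i' j'
    simp only [Matrix.single_apply, Matrix.smul_apply, vecMulVec_apply, Pi.star_apply,
      Pi.single_apply]
    by_cases hi : i = i' <;> by_cases hj : j = j' <;> simp [hi, hj, eq_comm]
  ext1 ρ
  rw [Matrix.matrix_eq_sum_single ρ]
  simp only [map_sum, h4, map_smul, h3, smul_zero, Finset.sum_const_zero, LinearMap.zero_apply]

variable (T root) in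
/-- The initial state as a linear function of the logical state. -/
def initialStateMap (M : T.edgeSet → ℕ) :
    Matrix (Fin D) (Fin D) ℂ →ₗ[ℂ] Op (inputSystems T root D M) where
  toFun ρ := initialState T root M ρ
  map_add' ρ σ := by
    ext x y
    simp [initialState, add_mul]
  map_smul' c ρ := by
    ext x y
    simp [initialState, mul_assoc]

/-- Both sides are linear in `ρ`, and the density operators span all matrices. This allows matrix
units as inputs, hence inputs entangled with the reference. -/
theorem Spreads.apply {U : Matrix (∀ v, Fin (d v)) (Fin D) ℂ} {M : T.edgeSet → ℕ}
    {S : SuperOp (inputSystems T root D M) (outputSystems d)} (h : Spreads T root U M S)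
    (ρ : Matrix (Fin D) (Fin D) ℂ) : S (initialState T root M ρ) = U * ρ * Uᴴ := by
  let L : Matrix (Fin D) (Fin D) ℂ →ₗ[ℂ] Op (outputSystems d) :=
    { toFun := fun ρ => (U * ρ * Uᴴ : Matrix (∀ v, Fin (d v)) (∀ v, Fin (d v)) ℂ)
      map_add' := fun ρ σ => by rw [Matrix.mul_add, Matrix.add_mul]; rfl
      map_smul' := fun c ρ => by rw [Matrix.mul_smul, Matrix.smul_mul]; rfl }
  have := eq_zero_of_forall_isDensity (S ∘ₗ initialStateMap T root M - L)
    fun ρ hρ => sub_eq_zero.2 (h ρ hρ)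
  exact sub_eq_zero.1 (LinearMap.congr_fun this ρ)

/-- The matrix whose rank is the rank of the reduced state. -/
def codeMatrix (U : Matrix (∀ v, Fin (d v)) (Fin D) ℂ) (A : Finset V) :
    Matrix (∀ v : {v // v ∈ A}, Fin (d v)) (Fin D × ∀ v : {v // v ∉ A}, Fin (d v)) ℂ :=
  Matrix.of fun a q => U (glue A a q.2) q.1

theorem codeMaxEntangled_apply (U : Matrix (∀ v, Fin (d v)) (Fin D) ℂ) (l : Fin D)
    (y : ∀ v, Fin (d v)) :
    codeMaxEntangled U (l, y) = (((1 / Real.sqrt D : ℝ)) : ℂ) * U y l := by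
  simp only [codeMaxEntangled, Matrix.mulVec, dotProduct, Fintype.sum_prod_type, kroneckerMap_apply,
    maxEntangled, Matrix.one_apply]
  simp [mul_comm]

theorem reducedCodeState_eq (U : Matrix (∀ v, Fin (d v)) (Fin D) ℂ) (A : Finset V) :
    reducedCodeState U A = ((((1 / Real.sqrt D : ℝ)) : ℂ) • codeMatrix U A) *
      ((((1 / Real.sqrt D : ℝ)) : ℂ) • codeMatrix U A)ᴴ := by
  ext a b
  simp only [reducedCodeState, partialTrace, Matrix.of_apply, vecMulVec_apply, Matrix.mul_apply,
    Fintype.sum_prod_type, Pi.star_apply, codeMaxEntangled_apply, Matrix.conjTranspose_apply,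
    Matrix.smul_apply, codeMatrix, smul_eq_mul]

/-- The reduced state is $CC^\dagger$ with $C$ a nonzero multiple of the code matrix, and
$CC^\dagger$ has the rank of $C$. -/
theorem rank_reducedCodeState (hD : 0 < D) (U : Matrix (∀ v, Fin (d v)) (Fin D) ℂ)
    (A : Finset V) : (reducedCodeState U A).rank = (codeMatrix U A).rank := by
  have hc : (((1 / Real.sqrt D : ℝ)) : ℂ) ≠ 0 := by
    have : 0 < Real.sqrt D := Real.sqrt_pos.2 (by exact_mod_cast hD)
    rw [Complex.ofReal_ne_zero]
    positivity
  rw [reducedCodeState_eq, Matrix.rank_self_mul_conjTranspose]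
  refine le_antisymm (rank_smul_le _ _) ?_
  have := rank_smul_le (((1 / Real.sqrt D : ℝ)) : ℂ)⁻¹ ((((1 / Real.sqrt D : ℝ)) : ℂ) • codeMatrix U A)
  rwa [smul_smul, inv_mul_cancel₀ hc, one_smul] at this

theorem mul_single_mul_conjTranspose_apply {m n : Type} [Fintype n] [DecidableEq n]
    (U : Matrix m n ℂ) (l l' : n) (y y' : m) :
    (U * Matrix.single l l' (1 : ℂ) * Uᴴ) y y' = U y l * star (U y' l') := by
  rw [Matrix.mul_apply, Finset.sum_eq_single l']
  · simp [Matrix.mul_apply, Matrix.single_apply, Matrix.conjTranspose_apply]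
  · intro k _ hk
    simp [Matrix.mul_apply, hk.symm]
  · simp

theorem rank_codeMatrix_le (hT : T.IsTree) {U : Matrix (∀ v, Fin (d v)) (Fin D) ℂ}
    {M : T.edgeSet → ℕ} (h : SpreadingAchievable T root U M) {v : V} (hv : v ≠ root) :
    (codeMatrix U (subtreeAt T root v)).rank ≤ M (parentEdge hT root v hv) := by
  obtain ⟨S, hS, hU⟩ := h
  have h1 := vecMulVec_mem_schmidtCone (hasSchmidtForm_referenceVec (D := D) hT root M hv)
  have h2 := PreservesSchmidt.of_isLOCC hS _ h1
  have h3 : extendMap S (vecMulVec (referenceVec (D := D) root M)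
      (star (referenceVec (D := D) root M))) =
      vecMulVec (fun p : Fin D × (outputSystems d).Joint => U p.2 p.1)
        (star (fun p : Fin D × (outputSystems d).Joint => U p.2 p.1)) := by
    ext p q
    -- The blocks of the input with respect to the reference are the initial states of matrix units.
    have e1 : (Matrix.of fun x x' => vecMulVec (referenceVec (D := D) root M)
      (star (referenceVec (D := D) root M)) (p.1, x) (q.1, x'))
        = initialState T root M (Matrix.single p.1 q.1 1) := by
      ext x y
      simp only [vecMulVec_apply, referenceVec, Matrix.of_apply, Pi.star_apply, initialState,
        Matrix.single_apply]
      split_ifs <;> simp_all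
    simp only [extendMap, Matrix.of_apply]
    rw [e1, hU.apply]
    exact mul_single_mul_conjTranspose_apply U p.1 q.1 p.2 q.2
  rw [h3] at h2
  -- The coefficient matrix of the output vector is `codeMatrix` by definition.
  exact rank_le_of_vecMulVec_mem_schmidtCone h2

end Necessity

/-! ### Partial isometries onto column spaces -/

section RangeIsometry

variable {n κ ι : Type} [Fintype n] [Fintype κ] [Fintype ι] [DecidableEq n] [DecidableEq κ]
  [DecidableEq ι]

/-- An orthonormal basis of the column space of a matrix. -/
theorem exists_orthonormal_columns (C : Matrix n κ ℂ) :
    ∃ (B : Matrix n (Fin C.rank) ℂ) (E : Matrix κ (Fin C.rank) ℂ),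
      B = C * E ∧ Bᴴ * B = 1 ∧ B * Bᴴ * C = C := by
  let S : Submodule ℂ (EuclideanSpace ℂ n) :=
    (LinearMap.range C.mulVecLin).map (WithLp.linearEquiv 2 ℂ (n → ℂ)).symm.toLinearMap
  have hS : Module.finrank ℂ S = C.rank := LinearEquiv.finrank_map_eq _ _
  let b : OrthonormalBasis (Fin C.rank) ℂ S := (stdOrthonormalBasis ℂ S).reindex (finCongr hS)
  have hmem : ∀ j, ∃ e : κ → ℂ, C *ᵥ e = (b j : EuclideanSpace ℂ n).ofLp := by
    intro j
    obtain ⟨x, ⟨e, he⟩, hx⟩ := (Submodule.mem_map).1 (b j).2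
    exact ⟨e, by rw [← hx, ← he]; rfl⟩
  choose e he using hmem
  refine ⟨Matrix.of fun y j => (b j : EuclideanSpace ℂ n).ofLp y, Matrix.of fun k j => e j k,
    ?_, ?_, ?_⟩
  · ext y j
    simp only [Matrix.of_apply, ← he]
    rfl
  · ext i j
    have h1 := orthonormal_iff_ite.1 b.orthonormal i j
    rw [Submodule.coe_inner, PiLp.inner_apply] at h1
    rw [Matrix.one_apply, ← h1, Matrix.mul_apply]
    refine Finset.sum_congr rfl fun y _ => ?_
    simp [mul_comm]
  · ext y k
    let x : S := ⟨WithLp.toLp 2 (C.col k), (Submodule.mem_map).2 ⟨C.col k,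
      ⟨Pi.single k 1, by simp⟩, rfl⟩⟩
    have h1 := congrArg (fun s : S => (s : EuclideanSpace ℂ n).ofLp y) (b.sum_repr' x)
    simp only [Submodule.coe_sum, Submodule.coe_smul, Submodule.coe_inner] at h1
    rw [WithLp.ofLp_sum, Finset.sum_apply] at h1
    simp only [x, WithLp.ofLp_smul, Pi.smul_apply, smul_eq_mul, PiLp.inner_apply] at h1
    rw [Matrix.mul_assoc, Matrix.mul_apply]
    refine Eq.trans (Finset.sum_congr rfl fun j _ => ?_) h1
    rw [Matrix.mul_apply, Matrix.of_apply, mul_comm]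
    congr 1
    refine Finset.sum_congr rfl fun y _ => ?_
    simp [mul_comm]

/-- If the rank of `C` is at most the size of `ι`, then there is a partial isometry from `ℂ^ι` onto
the column space of `C`. -/
theorem exists_partial_isometry (C : Matrix n κ ℂ) (h : C.rank ≤ Fintype.card ι) :
    ∃ (B : Matrix n ι ℂ) (E : Matrix κ ι ℂ),
      B = C * E ∧ (1 - Bᴴ * B).PosSemidef ∧ B * Bᴴ * C = C := by
  obtain ⟨B, E, hBE, hB, hC⟩ := exists_orthonormal_columns C
  obtain ⟨f⟩ := Function.Embedding.nonempty_of_card_le (α := Fin C.rank) (β := ι) (by simpa using h)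
  -- A coisometry; `Jᴴ * J` is a projection, so `1 - Jᴴ * J` is positive semidefinite.
  let J : Matrix (Fin C.rank) ι ℂ := Matrix.of fun j i => if f j = i then 1 else 0
  have hJ : J * Jᴴ = 1 := by
    ext i j
    simp [J, Matrix.mul_apply, Matrix.one_apply, Matrix.conjTranspose_apply, eq_comm]
  have hP : (Jᴴ * J) * (Jᴴ * J) = Jᴴ * J := by
    rw [Matrix.mul_assoc, ← Matrix.mul_assoc J, hJ, Matrix.one_mul]
  refine ⟨B * J, E * J, by rw [hBE, Matrix.mul_assoc], ?_, ?_⟩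
  · have h1 : (B * J)ᴴ * (B * J) = Jᴴ * J := by
      rw [Matrix.conjTranspose_mul, Matrix.mul_assoc, ← Matrix.mul_assoc Bᴴ, hB, Matrix.one_mul]
    have h2 : 1 - Jᴴ * J = (1 - Jᴴ * J)ᴴ * (1 - Jᴴ * J) := by
      rw [Matrix.conjTranspose_sub, Matrix.conjTranspose_one, Matrix.conjTranspose_mul,
        Matrix.conjTranspose_conjTranspose, Matrix.sub_mul, Matrix.mul_sub, Matrix.mul_sub, hP]
      simp
    rw [h1, h2]
    exact Matrix.posSemidef_conjTranspose_mul_self _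
  · rw [Matrix.conjTranspose_mul, Matrix.mul_assoc B, ← Matrix.mul_assoc J, hJ, Matrix.one_mul, hC]

end RangeIsometry

/-! ### Kernels acting on disjoint sets of parties -/

section Kernels

variable {V : Type} [Fintype V] [DecidableEq V] {Y : V → Type} [∀ v, Fintype (Y v)]
  [∀ v, DecidableEq (Y v)]

/-- The labels that agree with `y` outside `A`. -/
def agreeOff (A : Finset V) (y : ∀ v, Y v) : Finset (∀ v, Y v) :=
  Finset.univ.filter fun x => ∀ v, v ∉ A → x v = y v

theorem mem_agreeOff {A : Finset V} {x y : ∀ v, Y v} :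
    x ∈ agreeOff A y ↔ ∀ v, v ∉ A → x v = y v := by simp [agreeOff]

/-- If every kernel fixes `F`, so does their composition. As the kernels act on disjoint sets of
coordinates, the kernel of the composition is their product. -/
theorem sum_prod_kernel {ι : Type} [DecidableEq ι] (t : Finset ι) (A : ι → Finset V)
    (hA : ∀ c c', c ≠ c' → Disjoint (A c) (A c')) (p : ι → (∀ v, Y v) → (∀ v, Y v) → ℂ)
    (hp : ∀ c x x' y y', (∀ v ∈ A c, x v = x' v) → (∀ v ∈ A c, y v = y' v) → p c x y = p c x' y')
    (F : (∀ v, Y v) → ℂ) (hF : ∀ c ∈ t, ∀ x, ∑ y ∈ agreeOff (A c) x, p c x y * F y = F x)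
    (x : ∀ v, Y v) : ∑ y ∈ agreeOff (t.biUnion A) x, (∏ c ∈ t, p c x y) * F y = F x := by
  induction t using Finset.induction_on generalizing x with
  | empty =>
    have : agreeOff ((∅ : Finset ι).biUnion A) x = {x} := by
      ext y
      rw [mem_agreeOff, Finset.mem_singleton, funext_iff]
      simp
    rw [this]
    simp
  | insert c t hc ih =>
    have h1 := hF c (Finset.mem_insert_self c t) x
    rw [← h1]
    have ih' := ih fun c' hc' => hF c' (Finset.mem_insert_of_mem hc')
    have h2 : ∀ z ∈ agreeOff (A c) x, p c x z * F z
        = ∑ y ∈ agreeOff (t.biUnion A) z, p c x z * ((∏ c ∈ t, p c z y) * F y) := by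
      intro z _
      rw [← Finset.mul_sum, ih']
    rw [Finset.sum_congr rfl h2, Finset.sum_sigma']
    have hdisj : ∀ c' ∈ t, Disjoint (A c) (A c') := fun c' hc' => hA c c' fun h => hc (h ▸ hc')
    symm
    -- The intermediate label is determined by the endpoints: it equals `y` on `A c` and `x`
    -- elsewhere.
    refine Finset.sum_bij' (fun q _ => q.2) (fun y _ => ⟨(A c).piecewise y x, y⟩) ?_ ?_ ?_ ?_ ?_
    · rintro ⟨z, y⟩ hq
      simp only [Finset.mem_sigma, mem_agreeOff] at hq ⊢
      intro v hv
      rw [Finset.biUnion_insert, Finset.mem_union, not_or] at hv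
      rw [hq.2 v hv.2, hq.1 v hv.1]
    · intro y hy
      simp only [Finset.mem_sigma, mem_agreeOff] at hy ⊢
      refine ⟨fun v hv => Finset.piecewise_eq_of_notMem _ _ _ hv, fun v hv => ?_⟩
      by_cases hvc : v ∈ A c
      · rw [Finset.piecewise_eq_of_mem _ _ _ hvc]
      · rw [Finset.piecewise_eq_of_notMem _ _ _ hvc]
        exact hy v (by rw [Finset.biUnion_insert, Finset.mem_union, not_or]; exact ⟨hvc, hv⟩)
    · rintro ⟨z, y⟩ hq
      simp only [Finset.mem_sigma, mem_agreeOff] at hq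
      have : (A c).piecewise y x = z := by
        funext v
        by_cases hvc : v ∈ A c
        · rw [Finset.piecewise_eq_of_mem _ _ _ hvc]
          refine hq.2 v fun hv => ?_
          obtain ⟨c', hc', hv'⟩ := Finset.mem_biUnion.1 hv
          exact Finset.disjoint_left.1 (hdisj c' hc') hvc hv'
        · rw [Finset.piecewise_eq_of_notMem _ _ _ hvc, hq.1 v hvc]
      simp only [this]
    · intro y hy
      rfl
    · rintro ⟨z, y⟩ hq
      simp only [Finset.mem_sigma, mem_agreeOff] at hq
      rw [Finset.prod_insert hc, mul_assoc]
      congr 1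
      · refine hp c _ _ _ _ (fun _ _ => rfl) fun v hv => (hq.2 v fun hv' => ?_).symm
        obtain ⟨c', hc', hv'⟩ := Finset.mem_biUnion.1 hv'
        exact Finset.disjoint_left.1 (hdisj c' hc') hv hv'
      · congr 1
        refine Finset.prod_congr rfl fun c' hc' => hp c' _ _ _ _ (fun v hv => ?_) fun _ _ => rfl
        exact hq.1 v fun hv' => Finset.disjoint_left.1 (hdisj c' hc') hv' hv

end Kernels

/-! ### Contraction of tree tensor networks -/

section Network

variable {V : Type} [Fintype V] [DecidableEq V] (R : ParentTree V) {I : V → Type}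
  [∀ v, Fintype (I v)] [∀ v, DecidableEq (I v)]

/-- The partially contracted tree tensor network: the tensors of the vertices in `s` are present,
and those of the subtrees below `s` are contracted. Unused indices are fixed to `z0`. -/
def partialNetwork (w : ∀ v, (∀ c : R.Child v, I c) → I v → ℂ) (b : ∀ v, I v → ℂ)
    (z0 : ∀ v, I v) (s : Finset V) (u : V) (z : ∀ v, I v) : ℂ :=
  if u ∈ s then w u (fun c => z c) (z u)
  else if u = R.root ∨ R.par u ∈ s then b u (z u)
  else if z u = z0 u then 1 else 0

/-- By `hb`, the contracted tensor of `a` splits into `w a` and the contracted tensors of the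
children. The child indices, pinned to `z0` before, become summation indices. -/
theorem sum_partialNetwork_insert {w : ∀ v, (∀ c : R.Child v, I c) → I v → ℂ} {b : ∀ v, I v → ℂ}
    (hb : ∀ v i, b v i = ∑ z : (∀ c : R.Child v, I c), w v z i * ∏ c : R.Child v, b c (z c))
    (z0 : ∀ v, I v) (l : I R.root) {s : Finset V} {a : V} (ha : a ∉ s)
    (hs : ∀ v ∈ s, R.depth v ≤ R.depth a) (hpar : a ≠ R.root → R.par a ∈ s) :
    ∑ z : (∀ v, I v), (if z R.root = l then 1 else 0) * ∏ u, partialNetwork R w b z0 (insert a s) u z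
      = ∑ z : (∀ v, I v), (if z R.root = l then 1 else 0) * ∏ u, partialNetwork R w b z0 s u z := by
  let p : V → Prop := fun u => u ≠ R.root ∧ R.par u = a
  have hchild : ∀ u, p u → u ∉ insert a s := by
    intro u hu hus
    have h1 := R.depth_par_lt u hu.1
    rw [hu.2] at h1
    rcases Finset.mem_insert.1 hus with rfl | h
    · omega
    · have := hs u h
      omega
  have hpa : ¬ p a := fun h => hchild a h (Finset.mem_insert_self _ _)
  have hpr : ¬ p R.root := fun h => h.1 rfl
  let e := (Equiv.piEquivPiSubtypeProd p I).symm
  rw [← e.sum_comp, ← e.sum_comp, Fintype.sum_prod_type_right, Fintype.sum_prod_type_right]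
  refine Finset.sum_congr rfl fun zr _ => ?_
  have he1 : ∀ zc (u : V) (hu : p u), e (zc, zr) u = zc ⟨u, hu⟩ := fun zc u hu => by
    simp [e, Equiv.piEquivPiSubtypeProd, hu]
  have he2 : ∀ zc (u : V) (hu : ¬ p u), e (zc, zr) u = zr ⟨u, hu⟩ := fun zc u hu => by
    simp [e, Equiv.piEquivPiSubtypeProd, hu]
  -- The factors of the vertices other than `a` and its children do not see the indices of these
  -- children, so the latter can be set to `z0`.
  let rest : ℂ := ∏ u ∈ (Finset.univ : Finset {u // ¬ p u}).erase ⟨a, hpa⟩,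
    partialNetwork R w b z0 s u (e (fun u => z0 u, zr))
  have hrest : ∀ s', (s' = s ∨ s' = insert a s) → ∀ zc,
      ∏ u ∈ (Finset.univ : Finset {u // ¬ p u}).erase ⟨a, hpa⟩,
        partialNetwork R w b z0 s' u (e (zc, zr)) = rest := by
    intro s' hs' zc
    refine Finset.prod_congr rfl fun u hu => ?_
    have hua : (u : V) ≠ a := fun h => (Finset.ne_of_mem_erase hu) (Subtype.ext h)
    have hus : (u : V) ∈ s' ↔ (u : V) ∈ s := by
      rcases hs' with rfl | rfl
      · rfl
      · simp [hua]
    have hup : ((u : V) = R.root ∨ R.par u ∈ s') ↔ ((u : V) = R.root ∨ R.par u ∈ s) := by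
      rcases hs' with rfl | rfl
      · rfl
      · have : (u : V) = R.root ∨ R.par u ≠ a := by
          by_contra h
          push Not at h
          exact u.2 h
        rcases this with h | h
        · simp [h]
        · simp [h]
    unfold partialNetwork
    simp only [hus, hup, he2 _ _ u.2]
    have : (fun c : R.Child u => e (zc, zr) c) = fun c : R.Child u => e (fun u => z0 u, zr) c := by
      funext c
      have hc : ¬ p c := fun h => hua (c.2.2.symm.trans h.2)
      rw [he2 _ _ hc, he2 _ _ hc]
    rw [this]
  have hprod : ∀ s', (s' = s ∨ s' = insert a s) → ∀ zc,
      ∏ u, partialNetwork R w b z0 s' u (e (zc, zr)) =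
        (∏ u : {u // p u}, partialNetwork R w b z0 s' u (e (zc, zr))) *
          (partialNetwork R w b z0 s' a (e (zc, zr)) * rest) := by
    intro s' hs' zc
    rw [← Fintype.prod_subtype_mul_prod_subtype p, ← hrest s' hs' zc,
      Finset.mul_prod_erase _ (fun u : {u // ¬ p u} => partialNetwork R w b z0 s' u (e (zc, zr)))
        (Finset.mem_univ ⟨a, hpa⟩)]
  simp only [hprod _ (Or.inl rfl), hprod _ (Or.inr rfl), he2 _ _ hpr, ← Finset.mul_sum]
  congr 1
  have h1 : ∀ zc, partialNetwork R w b z0 s a (e (zc, zr)) = b a (zr ⟨a, hpa⟩) := by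
    intro zc
    have : a = R.root ∨ R.par a ∈ s := by
      by_cases h : a = R.root
      · exact Or.inl h
      · exact Or.inr (hpar h)
    simp [partialNetwork, ha, this, he2 _ _ hpa]
  have h2 : ∀ zc, partialNetwork R w b z0 (insert a s) a (e (zc, zr))
      = w a (fun c => zc ⟨c, c.2⟩) (zr ⟨a, hpa⟩) := by
    intro zc
    have : (fun c : R.Child a => e (zc, zr) c) = fun c : R.Child a => zc ⟨c, c.2⟩ := by
      funext c
      exact he1 _ _ c.2
    simp [partialNetwork, he2 _ _ hpa, this]
  have h3 : ∀ zc, ∏ u : {u // p u}, partialNetwork R w b z0 s u (e (zc, zr))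
      = ∏ u : {u // p u}, if zc u = z0 u then (1 : ℂ) else 0 := by
    intro zc
    refine Finset.prod_congr rfl fun u _ => ?_
    have h4 : (u : V) ∉ s := fun h => hchild u u.2 (Finset.mem_insert_of_mem h)
    simp [partialNetwork, h4, u.2.1, u.2.2, ha, he1 _ _ u.2]
  have h4 : ∀ zc, ∏ u : {u // p u}, partialNetwork R w b z0 (insert a s) u (e (zc, zr))
      = ∏ u : {u // p u}, b u (zc u) := by
    intro zc
    refine Finset.prod_congr rfl fun u _ => ?_
    have h4 := hchild u u.2
    simp only [partialNetwork, if_neg h4, u.2.2, Finset.mem_insert_self, or_true, if_true,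
      he1 _ _ u.2]
  simp only [h1, h2, h3, h4, ← Finset.sum_mul]
  have h5 : ∑ zc : (∀ u : {u // p u}, I u), ∏ u : {u // p u}, (if zc u = z0 u then (1 : ℂ) else 0)
      = 1 := by
    have := Finset.prod_univ_sum (fun u : {u // p u} => (Finset.univ : Finset (I u)))
      (fun u i => if i = z0 u then (1 : ℂ) else 0)
    rw [Fintype.piFinset_univ] at this
    rw [← this]
    simp
  rw [h5, one_mul, hb a, Finset.sum_mul]
  refine Finset.sum_congr rfl fun zc _ => ?_
  exact (by intros; ring : ∀ x y r : ℂ, x * (y * r) = (y * x) * r) _ _ _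

/-- Contraction of a tree tensor network. -/
theorem sum_network {w : ∀ v, (∀ c : R.Child v, I c) → I v → ℂ} {b : ∀ v, I v → ℂ}
    (hb : ∀ v i, b v i = ∑ z : (∀ c : R.Child v, I c), w v z i * ∏ c : R.Child v, b c (z c))
    (z0 : ∀ v, I v) (l : I R.root) :
    ∑ z : (∀ v, I v), (if z R.root = l then 1 else 0) * ∏ v, w v (fun c => z c) (z v)
      = b R.root l := by
  have key : ∀ s : Finset V, (∀ v ∈ s, v ≠ R.root → R.par v ∈ s) →
      ∑ z : (∀ v, I v), (if z R.root = l then 1 else 0) * ∏ u, partialNetwork R w b z0 s u z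
        = b R.root l := by
    intro s
    induction s using Finset.induction_on_max_value R.depth with
    | empty =>
      intro _
      -- In the fully contracted network all indices except the one at the root are pinned.
      rw [Finset.sum_eq_single (Function.update z0 R.root l)]
      · rw [if_pos (by simp), one_mul, Finset.prod_eq_single R.root]
        · simp [partialNetwork]
        · intro u _ hu
          simp [partialNetwork, hu]
        · simp
      · intro z _ hz
        by_cases hl : z R.root = l
        · obtain ⟨u, hu⟩ := Function.ne_iff.1 hz
          have hur : u ≠ R.root := by
            rintro rfl
            simp [hl] at hu
          rw [Function.update_of_ne hur] at hu
          rw [Finset.prod_eq_zero (Finset.mem_univ u), mul_zero]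
          simp [partialNetwork, hur, hu]
        · rw [if_neg hl, zero_mul]
      · simp
    | insert a s ha hs ih =>
      intro hclosed
      have hpar : a ≠ R.root → R.par a ∈ s := by
        intro h
        have h1 := R.depth_par_lt a h
        rcases Finset.mem_insert.1 (hclosed a (Finset.mem_insert_self _ _) h) with h2 | h2
        · rw [h2] at h1
          omega
        · exact h2
      rw [sum_partialNetwork_insert R hb z0 l ha hs hpar]
      refine ih fun v hv hr => ?_
      have h1 := R.depth_par_lt v hr
      rcases Finset.mem_insert.1 (hclosed v (Finset.mem_insert_of_mem hv) hr) with h2 | h2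
      · rw [h2] at h1
        have := hs v hv
        omega
      · exact h2
  have := key Finset.univ (by simp)
  simpa [partialNetwork] using this

end Network

/-! ### Decomposition of the isometry into a tree network -/

section Encoding

variable {V : Type} [Fintype V] [DecidableEq V] {Y : V → Type} [∀ v, Fintype (Y v)]
  [∀ v, DecidableEq (Y v)]

theorem piecewise_congr_left {A : Finset V} {x x' y : ∀ v, Y v} (h : ∀ v ∈ A, x v = x' v) :
    A.piecewise x y = A.piecewise x' y := by
  funext v
  by_cases hv : v ∈ A <;> simp [hv, h]

theorem piecewise_mem_agreeOff (A : Finset V) (x y : ∀ v, Y v) :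
    A.piecewise x y ∈ agreeOff A y :=
  mem_agreeOff.2 fun _ hv => Finset.piecewise_eq_of_notMem _ _ _ hv

theorem piecewise_eq_of_mem_agreeOff {A : Finset V} {x y : ∀ v, Y v} (h : x ∈ agreeOff A y) :
    A.piecewise x y = x := by
  funext v
  by_cases hv : v ∈ A
  · simp [hv]
  · simp [hv, mem_agreeOff.1 h v hv]

/-- Reindexing of sums over the labels with fixed coordinates outside `A`. -/
theorem sum_agreeOff_piecewise {A B : Finset V} (hAB : A ⊆ B) (x q : ∀ v, Y v)
    (g : (∀ v, Y v) → ℂ) :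
    ∑ y ∈ agreeOff A x, g (B.piecewise y q) = ∑ y ∈ agreeOff A (B.piecewise x q), g y := by
  refine Finset.sum_bij' (fun y _ => B.piecewise y q) (fun y _ => B.piecewise y x) ?_ ?_ ?_ ?_ ?_
  · intro y hy
    rw [mem_agreeOff] at hy ⊢
    intro v hv
    by_cases hvB : v ∈ B <;> simp [hvB, hy v hv]
  · intro y hy
    rw [mem_agreeOff] at hy ⊢
    intro v hv
    by_cases hvB : v ∈ B
    · have := hy v hv
      simpa [hvB] using this
    · simp [hvB]
  · intro y hy
    funext v
    by_cases hvB : v ∈ B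
    · simp [hvB]
    · simp [hvB, mem_agreeOff.1 hy v fun h => hvB (hAB h)]
  · intro y hy
    funext v
    by_cases hvB : v ∈ B
    · simp [hvB]
    · have := mem_agreeOff.1 hy v fun h => hvB (hAB h)
      simp [hvB, this]
  · intro y _
    rfl

variable {L : Type} [Fintype L] [DecidableEq L]

/-- The matrix whose columns are the slices of the columns of `U`, seen as vectors on the labels
which agree with `y0` outside `A`. -/
def sliceMatrix (U : Matrix (∀ v, Y v) L ℂ) (y0 : ∀ v, Y v) (A : Finset V) :
    Matrix (∀ v, Y v) (L × ∀ v, Y v) ℂ :=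
  Matrix.of fun y q => if y ∈ agreeOff A y0 then U (A.piecewise y q.2) q.1 else 0

/-- The slice matrix arises from the code matrix by multiplication with label embeddings on both
sides. -/
theorem rank_sliceMatrix_le {d : V → ℕ} {D : ℕ} (U : Matrix (∀ v, Fin (d v)) (Fin D) ℂ)
    (f : L → Fin D) (y0 : ∀ v, Fin (d v)) (A : Finset V) :
    (sliceMatrix (U.submatrix id f) y0 A).rank ≤ (codeMatrix U A).rank := by
  have h : sliceMatrix (U.submatrix id f) y0 A =
      (Matrix.of fun (y : ∀ v, Fin (d v)) (a : ∀ v : {v // v ∈ A}, Fin (d v)) =>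
        if y ∈ agreeOff A y0 then if a = (fun v : {v // v ∈ A} => y v) then (1 : ℂ) else 0 else 0) *
        codeMatrix U A *
        (Matrix.of fun (p : Fin D × ∀ v : {v // v ∉ A}, Fin (d v)) (q : L × ∀ v, Fin (d v)) =>
          if p = (f q.1, fun v : {v // v ∉ A} => q.2 v) then (1 : ℂ) else 0) := by
    ext y q
    have hg : glue A (fun v => y v) (fun v => q.2 v) = A.piecewise y q.2 := by
      funext v
      by_cases hv : v ∈ A <;> simp [glue, hv]
    rw [Matrix.mul_assoc, Matrix.mul_apply]
    simp only [Matrix.mul_apply, Matrix.of_apply, mul_ite, mul_one, mul_zero, Finset.sum_ite_eq',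
      Finset.mem_univ, if_true, sliceMatrix, ite_mul, one_mul, zero_mul]
    by_cases hy : y ∈ agreeOff A y0
    · simp [hy, codeMatrix, hg]
    · simp [hy]
  rw [h]
  exact (Matrix.rank_mul_le_left _ _).trans (Matrix.rank_mul_le_right _ _)

/-- Local encoding maps for the subsystem `A`. -/
theorem exists_local_encoding {ι : Type} [Fintype ι] [DecidableEq ι]
    (U : Matrix (∀ v, Y v) L ℂ) (y0 : ∀ v, Y v) (A : Finset V)
    (h : (sliceMatrix U y0 A).rank ≤ Fintype.card ι) :
    ∃ b : (∀ v, Y v) → ι → ℂ,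
      (∀ x x', (∀ v ∈ A, x v = x' v) → b x = b x') ∧
      (∀ x l, ∑ y ∈ agreeOff A x, (∑ i, b x i * star (b y i)) * U y l = U x l) ∧
      (∃ E : L × (∀ v, Y v) → ι → ℂ, ∀ x i, b x i = ∑ q, E q i * U (A.piecewise x q.2) q.1) ∧
      (1 - Matrix.of fun i j => ∑ y ∈ agreeOff A y0, star (b y i) * b y j).PosSemidef := by
  obtain ⟨B, E, hBE, hpsd, hB⟩ := exists_partial_isometry (ι := ι) (sliceMatrix U y0 A) h
  have hB0 : ∀ y, y ∉ agreeOff A y0 → ∀ i, B y i = 0 := by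
    intro y hy i
    rw [hBE, Matrix.mul_apply]
    refine Finset.sum_eq_zero fun q _ => ?_
    simp [sliceMatrix, hy]
  -- `B` is supported on labels equal to `y0` off `A`. Resetting the other coordinates to `y0` gives
  -- a function of the coordinates in `A` alone, which can act on any slice.
  refine ⟨fun y i => B (A.piecewise y y0) i, fun x x' hx => ?_, fun x l => ?_, ⟨E, fun x i => ?_⟩, ?_⟩
  · simp only [piecewise_congr_left hx]
  · have h1 := congrFun (congrFun hB (A.piecewise x y0)) (l, x)
    have h2 : A.piecewise (A.piecewise x y0) x = x := by
      funext v
      by_cases hv : v ∈ A <;> simp [hv]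
    simp only [sliceMatrix, Matrix.of_apply, piecewise_mem_agreeOff, if_true, h2] at h1
    rw [← h1, Matrix.mul_apply]
    simp only [Matrix.of_apply, mul_ite, mul_zero]
    rw [← Finset.sum_filter, Finset.filter_mem_eq_inter, Finset.univ_inter]
    refine Finset.sum_bij' (fun y _ => A.piecewise y y0) (fun y _ => A.piecewise y x) ?_ ?_ ?_ ?_ ?_
    · exact fun y _ => piecewise_mem_agreeOff _ _ _
    · exact fun y _ => piecewise_mem_agreeOff _ _ _
    · intro y hy
      funext v
      by_cases hv : v ∈ A
      · simp [hv]
      · simp [hv, mem_agreeOff.1 hy v hv]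
    · intro y hy
      funext v
      by_cases hv : v ∈ A
      · simp [hv]
      · simp [hv, mem_agreeOff.1 hy v hv]
    · intro y hy
      have h3 : A.piecewise (A.piecewise y y0) x = y := by
        funext v
        by_cases hv : v ∈ A
        · simp [hv]
        · simp [hv, mem_agreeOff.1 hy v hv]
      rw [h3, Matrix.mul_apply]
      rfl
  · have h1 : ∀ q, A.piecewise (A.piecewise x y0) q = A.piecewise x q := by
      intro q
      funext v
      by_cases hv : v ∈ A <;> simp [hv]
    beta_reduce
    rw [hBE, Matrix.mul_apply]
    refine Finset.sum_congr rfl fun q _ => ?_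
    simp only [sliceMatrix, Matrix.of_apply, piecewise_mem_agreeOff, if_true, h1, mul_comm]
  · convert hpsd using 2
    ext i j
    rw [Matrix.mul_apply, Matrix.of_apply]
    rw [← Finset.sum_subset (Finset.subset_univ (agreeOff A y0))]
    · refine Finset.sum_congr rfl fun y hy => ?_
      beta_reduce
      rw [piecewise_eq_of_mem_agreeOff hy]
      rfl
    · intro y _ hy
      rw [hB0 y hy j, mul_zero]

variable (R : ParentTree V) {I : V → Type} [∀ v, Fintype (I v)] [∀ v, DecidableEq (I v)]

/-- The tensor of a vertex obtained from local encoding maps of the subtrees. -/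
def vertexTensor (y0 : ∀ v, Y v) (b : ∀ v, (∀ v, Y v) → I v → ℂ) (v : V) :
    Matrix (Y v × ∀ c : R.Child v, I c) (I v) ℂ :=
  Matrix.of fun p i => ∑ y ∈ agreeOff (R.subtree v) y0,
    if y v = p.1 then (∏ c : R.Child v, star (b c y (p.2 c))) * b v y i else 0

theorem mem_agreeOff_children {v : V} {x y0 y : ∀ v, Y v} :
    y ∈ agreeOff (Finset.univ.biUnion fun c : R.Child v => R.subtree c)
      ((R.subtree v).piecewise x y0) ↔ y ∈ agreeOff (R.subtree v) y0 ∧ y v = x v := by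
  simp only [mem_agreeOff]
  constructor
  · intro h
    refine ⟨fun u hu => ?_, ?_⟩
    · have hu' : u ∉ Finset.univ.biUnion fun c : R.Child v => R.subtree c := by
        intro h'
        obtain ⟨c, _, hc⟩ := Finset.mem_biUnion.1 h'
        exact hu (R.subtree_child_subset c hc)
      rw [h u hu', Finset.piecewise_eq_of_notMem _ _ _ hu]
    · have hv' : v ∉ Finset.univ.biUnion fun c : R.Child v => R.subtree c := by
        intro h'
        obtain ⟨c, _, hc⟩ := Finset.mem_biUnion.1 h'
        exact R.notMem_subtree_child c hc
      rw [h v hv', Finset.piecewise_eq_of_mem _ _ _ (R.self_mem_subtree v)]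
  · rintro ⟨h1, h2⟩ u hu
    by_cases huv : u ∈ R.subtree v
    · have : u = v := by
        by_contra hne
        obtain ⟨c, hc⟩ := R.exists_mem_subtree_child huv hne
        exact hu (Finset.mem_biUnion.2 ⟨c, Finset.mem_univ _, hc⟩)
      subst this
      rw [h2, Finset.piecewise_eq_of_mem _ _ _ huv]
    · rw [h1 u huv, Finset.piecewise_eq_of_notMem _ _ _ huv]

-- Contracting the tensor of `v` with the encodings of its children applies the projections
-- $b_cb_c^\dagger$ to $b_v$. They act on disjoint subtrees, and each fixes $b_v$, because $b_v$ is
-- a combination of slices of $U$, which these projections fix.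
variable {R} in
theorem sum_vertexTensor_mul (U : Matrix (∀ v, Y v) L ℂ) (y0 : ∀ v, Y v)
    {b : ∀ v, (∀ v, Y v) → I v → ℂ}
    (h1 : ∀ v x x', (∀ u ∈ R.subtree v, x u = x' u) → b v x = b v x')
    (h2 : ∀ v, v ≠ R.root → ∀ x l,
      ∑ y ∈ agreeOff (R.subtree v) x, (∑ i, b v x i * star (b v y i)) * U y l = U x l)
    (h3 : ∀ v, ∃ E : L × (∀ v, Y v) → I v → ℂ, ∀ x i,
      b v x i = ∑ q, E q i * U ((R.subtree v).piecewise x q.2) q.1) (v : V) (x : ∀ v, Y v)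
    (i : I v) :
    ∑ z : (∀ c : R.Child v, I c), vertexTensor R y0 b v (x v, z) i * ∏ c : R.Child v, b c x (z c)
      = b v x i := by
  have key := sum_prod_kernel (Finset.univ : Finset (R.Child v)) (fun c => R.subtree c)
    (fun c c' h => R.disjoint_subtree_child h) (fun c x y => ∑ j, b c x j * star (b c y j))
    (fun c x x' y y' hx hy => by simp only [h1 c x x' hx, h1 c y y' hy]) (fun y => b v y i)
    (fun c _ x' => ?_) ((R.subtree v).piecewise x y0)
  · have e1 : ∀ c : R.Child v, b c ((R.subtree v).piecewise x y0) = b c x := fun c =>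
      h1 c _ _ fun u hu => Finset.piecewise_eq_of_mem _ _ _ (R.subtree_child_subset c hu)
    have e2 : b v ((R.subtree v).piecewise x y0) = b v x :=
      h1 v _ _ fun u hu => Finset.piecewise_eq_of_mem _ _ _ hu
    simp only [e1, e2] at key
    rw [← key]
    simp only [vertexTensor, Matrix.of_apply, Finset.sum_mul]
    rw [Finset.sum_comm]
    have e3 : agreeOff (Finset.univ.biUnion fun c : R.Child v => R.subtree c)
        ((R.subtree v).piecewise x y0)
        = (agreeOff (R.subtree v) y0).filter fun y => y v = x v := by
      ext y
      rw [mem_agreeOff_children, Finset.mem_filter]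
    rw [e3, Finset.sum_filter]
    refine Finset.sum_congr rfl fun y _ => ?_
    split_ifs with hy
    · rw [Finset.prod_univ_sum, Fintype.piFinset_univ, Finset.sum_mul]
      refine Finset.sum_congr rfl fun z _ => ?_
      rw [Finset.prod_mul_distrib]
      ring
    · simp
  · obtain ⟨E, hE⟩ := h3 v
    simp only [hE, Finset.mul_sum]
    rw [Finset.sum_comm]
    refine Finset.sum_congr rfl fun q _ => ?_
    rw [← h2 c c.2.1 ((R.subtree v).piecewise x' q.2) q.1, ← sum_agreeOff_piecewise
      (R.subtree_child_subset c) x' q.2 (fun y => (∑ i, b c ((R.subtree v).piecewise x' q.2) i *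
        star (b c y i)) * U y q.1), Finset.mul_sum]
    refine Finset.sum_congr rfl fun y _ => ?_
    have e1 : ∀ x, b c ((R.subtree v).piecewise x q.2) = b c x := fun x =>
      h1 c _ _ fun u hu => Finset.piecewise_eq_of_mem _ _ _ (R.subtree_child_subset c hu)
    rw [e1, e1]
    ring

/-- An isometry whose slices have small rank is a tree tensor network of contractions. -/
theorem exists_tree_network (U : Matrix (∀ v, Y v) (I R.root) ℂ) (hU : Uᴴ * U = 1)
    (y0 : ∀ v, Y v) (z0 : ∀ v, I v)
    (hrank : ∀ v, v ≠ R.root → (sliceMatrix U y0 (R.subtree v)).rank ≤ Fintype.card (I v)) :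
    ∃ W : ∀ v, Matrix (Y v × ∀ c : R.Child v, I c) (I v) ℂ,
      (∀ v, (1 - (W v)ᴴ * W v).PosSemidef) ∧
      ∀ y l, ∑ z : (∀ v, I v), (if z R.root = l then 1 else 0) *
        ∏ v, W v (y v, fun c => z c) (z v) = U y l := by
  have huniv : R.subtree R.root = Finset.univ := by
    ext v
    simp [R.mem_subtree_root v]
  have hex : ∀ v, ∃ b : (∀ v, Y v) → I v → ℂ,
      (∀ x x', (∀ u ∈ R.subtree v, x u = x' u) → b x = b x') ∧
      (v ≠ R.root → ∀ x l,
        ∑ y ∈ agreeOff (R.subtree v) x, (∑ i, b x i * star (b y i)) * U y l = U x l) ∧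
      (∃ E : I R.root × (∀ v, Y v) → I v → ℂ, ∀ x i,
        b x i = ∑ q, E q i * U ((R.subtree v).piecewise x q.2) q.1) ∧
      (1 - Matrix.of fun i j => ∑ y ∈ agreeOff (R.subtree v) y0, star (b y i) * b y j).PosSemidef ∧
      ∀ h : v = R.root, ∀ y i, b y i = U y (h ▸ i) := by
    intro v
    -- At the root no compression takes place: the encoding is `U` itself.
    by_cases hv : v = R.root
    · subst hv
      refine ⟨fun y i => U y i, fun x x' h => ?_, fun h => absurd rfl h,
        ⟨fun q i => if q = (i, y0) then 1 else 0, fun x i => ?_⟩, ?_, fun _ _ _ => rfl⟩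
      · have : x = x' := funext fun u => h u (R.mem_subtree_root u)
        rw [this]
      · have h0 : (R.subtree R.root).piecewise x y0 = x :=
          funext fun u => Finset.piecewise_eq_of_mem _ _ _ (R.mem_subtree_root u)
        simp [h0]
      · have h1 : (Matrix.of fun i j => ∑ y ∈ agreeOff (R.subtree R.root) y0,
            star (U y i) * U y j) = 1 := by
          rw [← hU]
          ext i j
          have : agreeOff (R.subtree R.root) y0 = Finset.univ := by
            ext y
            simp [mem_agreeOff, huniv]
          rw [this]
          rfl
        rw [h1, sub_self]
        exact Matrix.PosSemidef.zero
    · obtain ⟨b, h1, h2, h3, h4⟩ := exists_local_encoding U y0 (R.subtree v) (hrank v hv)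
      exact ⟨b, h1, fun _ => h2, h3, h4, fun h => absurd h hv⟩
  choose b h1 h2 h3 h4 h5 using hex
  have key := sum_vertexTensor_mul U y0 h1 h2 h3
  refine ⟨fun v => vertexTensor R y0 b v, fun v => ?_, fun y l => ?_⟩
  -- Since the child projections fix $b_v$, the matrix $W_v^\dagger W_v$ equals $b_v^\dagger b_v$.
  · convert h4 v using 2
    ext i j
    rw [Matrix.mul_apply, Matrix.of_apply, Fintype.sum_prod_type]
    have e1 : ∀ (α : Y v) z, (vertexTensor R y0 b v)ᴴ i (α, z) * vertexTensor R y0 b v (α, z) j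
        = ∑ y ∈ agreeOff (R.subtree v) y0, if y v = α then star (b v y i) *
          (vertexTensor R y0 b v (y v, z) j * ∏ c : R.Child v, b c y (z c)) else 0 := by
      intro α z
      rw [Matrix.conjTranspose_apply]
      conv_lhs => rw [vertexTensor, Matrix.of_apply, star_sum, Finset.sum_mul]
      refine Finset.sum_congr rfl fun y _ => ?_
      split_ifs with hy
      · subst hy
        simp only [star_mul', star_prod, star_star]
        rw [vertexTensor]
        ring
      · simp
    simp only [e1]
    calc _ = ∑ α, ∑ y ∈ agreeOff (R.subtree v) y0, if y v = α then star (b v y i) * b v y j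
          else 0 := by
          refine Finset.sum_congr rfl fun α _ => ?_
          rw [Finset.sum_comm]
          refine Finset.sum_congr rfl fun y _ => ?_
          split_ifs with hy
          · rw [← Finset.mul_sum, key]
          · simp
      _ = _ := by
          rw [Finset.sum_comm]
          refine Finset.sum_congr rfl fun y _ => ?_
          simp
  · have := sum_network R (w := fun v z i => vertexTensor R y0 b v (y v, z) i)
      (b := fun v => b v y) (fun v i => (key v y i).symm) z0 l
    rw [this, h5 R.root rfl]

end Encoding

/-! ### Teleportation along the edges -/

section Teleportation

variable {V : Type} [Fintype V] [DecidableEq V] (R : ParentTree V) {I : V → Type}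
  [∀ v, Fintype (I v)] [∀ v, DecidableEq (I v)] [∀ v, AddCommGroup (I v)]

theorem prod_prod_child (f : V → ℂ) :
    ∏ v, ∏ c : R.Child v, f c = ∏ w : {w : V // w ≠ R.root}, f w := by
  rw [Finset.prod_sigma']
  refine Finset.prod_bij' (fun p _ => ⟨p.2, p.2.2.1⟩) (fun w _ => ⟨R.par w, ⟨w, w.2, rfl⟩⟩)
    ?_ ?_ ?_ ?_ ?_
  · simp
  · simp
  · rintro ⟨v, c, hc, rfl⟩ _
    rfl
  · simp
  · simp

/-- The input labels of a vertex: its label in the system shared with its parent (or, at the root,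
in the logical system) and its labels in the systems shared with its children. -/
abbrev VertexInput (I : V → Type) (v : V) : Type := I v × ∀ c : R.Child v, I c

/-- Maximally entangled states on all edges, and the logical system at the root. -/
def edgeResource (x : ∀ v, VertexInput R I v) (l : I R.root) : ℂ :=
  (if (x R.root).1 = l then 1 else 0) * ∏ w : {w : V // w ≠ R.root},
    if (x (R.par w)).2 ⟨w, w.2, rfl⟩ = (x w).1
      then (((1 / Real.sqrt (Fintype.card (I w)) : ℝ)) : ℂ) else 0

/-- The resource is supported where both ends of every edge agree; such labels amount to one label
per vertex, that of the edge above it. -/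
theorem sum_mul_edgeResource (F : (∀ v, VertexInput R I v) → ℂ) (l : I R.root) :
    ∑ x, F x * edgeResource R x l = ∑ u : (∀ v, I v), (F fun v => (u v, fun c => u c)) *
      ((if u R.root = l then 1 else 0) * ∏ w : {w : V // w ≠ R.root},
        (((1 / Real.sqrt (Fintype.card (I w)) : ℝ)) : ℂ)) := by
  let φ : (∀ v, I v) ↪ (∀ v, VertexInput R I v) :=
    ⟨fun u v => (u v, fun c => u c), fun u u' h => funext fun v => congrArg Prod.fst (congrFun h v)⟩
  rw [← Finset.sum_subset (Finset.subset_univ (Finset.univ.map φ)), Finset.sum_map]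
  · refine Finset.sum_congr rfl fun u _ => ?_
    change (F fun v => (u v, fun c => u c)) * edgeResource R (fun v => (u v, fun c => u c)) l = _
    simp [edgeResource]
  · intro x _ hx
    by_cases h : ∀ w : {w : V // w ≠ R.root}, (x (R.par w)).2 ⟨w, w.2, rfl⟩ = (x w).1
    · refine absurd (Finset.mem_map.2 ⟨fun v => (x v).1, Finset.mem_univ _, ?_⟩) hx
      funext v
      refine Prod.ext rfl (funext fun c => ?_)
      obtain ⟨c, hc, rfl⟩ := c
      exact (h ⟨c, hc⟩).symm
    · push Not at h
      obtain ⟨w, hw⟩ := h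
      rw [edgeResource, Finset.prod_eq_zero (Finset.mem_univ w) (if_neg hw), mul_zero, mul_zero]

theorem sqrt_card_inv_sq (w : V) : (((1 / Real.sqrt (Fintype.card (I w)) : ℝ)) : ℂ) *
    (((1 / Real.sqrt (Fintype.card (I w)) : ℝ)) : ℂ) = (Fintype.card (I w) : ℂ)⁻¹ := by
  rw [← Complex.ofReal_mul, div_mul_div_comm, Real.mul_self_sqrt (Nat.cast_nonneg _)]
  simp

theorem sum_star_edgeResource_mul (l l' : I R.root) :
    ∑ x, star (edgeResource R x l) * edgeResource R x l' = if l = l' then 1 else 0 := by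
  rw [sum_mul_edgeResource R (fun x => star (edgeResource R x l))]
  -- The normalization is itself a tree contraction: each vertex averages over the labels of its
  -- children, so every contracted tensor is 1.
  have h1 := sum_network R (I := I) (w := fun v _ _ => ∏ c : R.Child v, (Fintype.card (I c) : ℂ)⁻¹)
    (b := fun _ _ => 1) (fun v _ => by
      simp [Finset.card_univ, Fintype.card_pi, Finset.prod_ne_zero_iff]) (fun _ => 0) l
  simp only [prod_prod_child R (fun c => (Fintype.card (I c) : ℂ)⁻¹)] at h1
  have h2 : ∀ u : (∀ v, I v), star (edgeResource R (fun v => (u v, fun c : R.Child v => u c)) l) *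
      ((if u R.root = l' then 1 else 0) * ∏ w : {w : V // w ≠ R.root},
        (((1 / Real.sqrt (Fintype.card (I w)) : ℝ)) : ℂ)) =
      (if l = l' then 1 else 0) * ((if u R.root = l then 1 else 0) *
        ∏ w : {w : V // w ≠ R.root}, (Fintype.card (I w) : ℂ)⁻¹) := by
    intro u
    have h3 : edgeResource R (fun v => (u v, fun c : R.Child v => u c)) l
        = (if u R.root = l then 1 else 0) * ∏ w : {w : V // w ≠ R.root},
        (((1 / Real.sqrt (Fintype.card (I w)) : ℝ)) : ℂ) := by
      simp [edgeResource]
    rw [h3]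
    by_cases hl : u R.root = l
    · by_cases hl' : l = l'
      · simp only [hl, hl', if_true, one_mul, star_prod, RCLike.star_def, Complex.conj_ofReal,
          ← Finset.prod_mul_distrib, sqrt_card_inv_sq]
      · have : u R.root ≠ l' := fun h => hl' (hl.symm.trans h)
        simp [hl', this]
    · simp [hl]
  simp only [h2, ← Finset.mul_sum]
  rw [h1, mul_one]

/-- The outcomes of the generalized Bell measurement of a vertex on all edges to its children. -/
abbrev BellOutcome (I : V → Type) [∀ v, AddCommGroup (I v)] (v : V) : Type :=
  (∀ c : R.Child v, I c) × (∀ c : R.Child v, AddChar (I c) ℂ)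

/-- The outcomes of the instrument of a vertex: those of the Bell measurement, and those which
never occur as they indicate that the received state is not in the support of the code. -/
abbrev VertexOutcome (I : V → Type) [∀ v, AddCommGroup (I v)] (v : V) : Type :=
  BellOutcome R I v ⊕ VertexInput R I v

/-- The correction which a vertex applies to the state received from its parent. -/
def correction (o : ∀ v, VertexOutcome R I v) (v : V) : I v × AddChar (I v) ℂ :=
  if h : v ≠ R.root then
    match o (R.par v) with
    | .inl k => (k.1 ⟨v, h, rfl⟩, k.2 ⟨v, h, rfl⟩)
    | .inr _ => (0, 1)
  else (0, 1)

theorem correction_child (k : ∀ v, BellOutcome R I v) {v : V} (c : R.Child v) :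
    correction R (fun v => .inl (k v)) c = ((k v).1 c, (k v).2 c) := by
  obtain ⟨c, hc, rfl⟩ := c
  simp [correction, hc]

theorem correction_root (o : ∀ v, VertexOutcome R I v) : correction R o R.root = (0, 1) := by
  simp [correction]

variable {R} in
/-- The Kraus operators of a vertex: it corrects the received state, encodes it by `W`, and
teleports the systems of its children. -/
def vertexKraus {v : V} {Y : Type} [DecidableEq Y] (W : Matrix (Y × ∀ c : R.Child v, I c) (I v) ℂ)
    (N : Matrix (I v) (I v) ℂ) (y0 : Y) (s : I v × AddChar (I v) ℂ) :
    VertexOutcome R I v → Matrix Y (VertexInput R I v) ℂ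
  | .inl k => Matrix.of fun y x => W (y, fun c => x.2 c + k.1 c) (x.1 + s.1) * s.2 x.1 *
      ∏ c : R.Child v, (star (k.2 c (x.2 c)) * (((1 / Real.sqrt (Fintype.card (I c)) : ℝ)) : ℂ))
  -- The completion of `W` to an instrument: after `N`, all labels are measured and the fixed label
  -- `y0` is put out.
  | .inr p => Matrix.of fun y x => if y = y0 ∧ x.2 = p.2 then N p.1 (x.1 + s.1) * s.2 x.1 else 0

theorem star_addChar_mul_self {G : Type} [AddCommGroup G] [Finite G] (χ : AddChar G ℂ) (a : G) :
    star (χ a) * χ a = 1 := by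
  rw [RCLike.star_def, Complex.conj_mul', AddChar.norm_apply]
  simp

theorem sum_addChar_mul_star {G : Type} [AddCommGroup G] [Fintype G] [DecidableEq G] (a b : G) :
    ∑ χ : AddChar G ℂ, χ a * star (χ b) = if a = b then (Fintype.card G : ℂ) else 0 := by
  have h : ∀ χ : AddChar G ℂ, χ a * star (χ b) = χ (a - b) := by
    intro χ
    rw [sub_eq_add_neg, AddChar.map_add_eq_mul, AddChar.map_neg_eq_conj]
    rfl
  simp only [h, AddChar.sum_apply_eq_ite, sub_eq_zero]

/-- Orthogonality of characters makes the Bell outcomes contribute $W^\dagger W$ and the others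
$N^\dagger N$, both conjugated by the unitary correction and tensored with the identity on the
shares towards the children. -/
theorem sum_vertexKraus_effect {v : V} {Y : Type} [Fintype Y] [DecidableEq Y]
    (W : Matrix (Y × ∀ c : R.Child v, I c) (I v) ℂ) (N : Matrix (I v) (I v) ℂ)
    (hN : 1 - Wᴴ * W = Nᴴ * N) (y0 : Y) (s : I v × AddChar (I v) ℂ) :
    ∑ o, (vertexKraus W N y0 s o)ᴴ * vertexKraus W N y0 s o = 1 := by
  ext ⟨u, q⟩ ⟨u', q'⟩
  have hsum : (Wᴴ * W) (u + s.1) (u' + s.1) + (Nᴴ * N) (u + s.1) (u' + s.1)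
      = if u = u' then 1 else 0 := by
    rw [← Matrix.add_apply, ← hN, add_sub_cancel, Matrix.one_apply]
    simp
  have hinl : ∑ k : BellOutcome R I v, ((vertexKraus W N y0 s (.inl k))ᴴ *
      vertexKraus W N y0 s (.inl k)) (u, q) (u', q') =
      if q = q' then star (s.2 u) * s.2 u' * (Wᴴ * W) (u + s.1) (u' + s.1) else 0 := by
    have h1 : ∀ (a : ∀ c : R.Child v, I c) (χ : ∀ c : R.Child v, AddChar (I c) ℂ),
        ((vertexKraus W N y0 s (.inl (a, χ)))ᴴ * vertexKraus W N y0 s (.inl (a, χ))) (u, q) (u', q')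
        = star (s.2 u) * s.2 u' *
          (∑ y, star (W (y, q + a) (u + s.1)) * W (y, q' + a) (u' + s.1)) *
          ∏ c : R.Child v, ((χ c (q c) * star (χ c (q' c))) * (Fintype.card (I c) : ℂ)⁻¹) := by
      intro a χ
      rw [Matrix.mul_apply, Finset.mul_sum, Finset.sum_mul]
      refine Finset.sum_congr rfl fun y _ => ?_
      rw [Matrix.conjTranspose_apply]
      simp only [vertexKraus, Matrix.of_apply, star_mul', star_prod, RCLike.star_def,
        starRingEnd_self_apply, Complex.conj_ofReal, ← sqrt_card_inv_sq, Finset.prod_mul_distrib]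
      change _ = _ * ((starRingEnd ℂ) (W (y, fun c => q c + a c) (u + s.1)) *
        W (y, fun c => q' c + a c) (u' + s.1)) * _
      ring
    have h2 : ∑ χ : (∀ c : R.Child v, AddChar (I c) ℂ),
        ∏ c : R.Child v, ((χ c (q c) * star (χ c (q' c))) * (Fintype.card (I c) : ℂ)⁻¹)
        = if q = q' then 1 else 0 := by
      have h3 := Finset.prod_univ_sum (fun c : R.Child v => (Finset.univ : Finset (AddChar (I c) ℂ)))
        (fun c χ => (χ (q c) * star (χ (q' c))) * (Fintype.card (I c) : ℂ)⁻¹)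
      rw [Fintype.piFinset_univ] at h3
      rw [← h3]
      simp only [← Finset.sum_mul, sum_addChar_mul_star]
      split_ifs with hq
      · simp [hq]
      · obtain ⟨c, hc⟩ := Function.ne_iff.1 hq
        exact Finset.prod_eq_zero (Finset.mem_univ c) (by simp [hc])
    rw [Fintype.sum_prod_type]
    simp only [h1, ← Finset.mul_sum, h2]
    split_ifs with hq
    · subst hq
      simp only [mul_one]
      rw [← Finset.mul_sum]
      congr 1
      rw [Matrix.mul_apply, Fintype.sum_prod_type_right]
      exact Fintype.sum_equiv (Equiv.addLeft q) _ _ fun a => rfl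
    · simp
  have hinr : ∑ p : VertexInput R I v, ((vertexKraus W N y0 s (.inr p))ᴴ *
      vertexKraus W N y0 s (.inr p)) (u, q) (u', q') =
      if q = q' then star (s.2 u) * s.2 u' * (Nᴴ * N) (u + s.1) (u' + s.1) else 0 := by
    have h1 : ∀ p : VertexInput R I v, ((vertexKraus W N y0 s (.inr p))ᴴ *
        vertexKraus W N y0 s (.inr p)) (u, q) (u', q') = if p.2 = q ∧ q' = q then
          star (s.2 u) * s.2 u' * (star (N p.1 (u + s.1)) * N p.1 (u' + s.1)) else 0 := by
      intro p
      rw [Matrix.mul_apply, Finset.sum_eq_single y0]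
      · rw [Matrix.conjTranspose_apply]
        simp only [vertexKraus, Matrix.of_apply, true_and]
        by_cases h : q = p.2
        · by_cases h' : q' = q
          · rw [if_pos h, if_pos (h'.trans h), if_pos ⟨h.symm, h'⟩, star_mul']
            ring
          · have h2 : ¬ q' = p.2 := fun h'' => h' (h''.trans h.symm)
            have h3 : ¬ (p.2 = q ∧ q' = q) := fun h'' => h' h''.2
            rw [if_neg h2, if_neg h3, mul_zero]
        · have h3 : ¬ (p.2 = q ∧ q' = q) := fun h'' => h h''.1.symm
          rw [if_neg h, if_neg h3, star_zero, zero_mul]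
      · intro y _ hy
        simp [vertexKraus, hy]
      · simp
    simp only [h1]
    rw [Fintype.sum_prod_type_right]
    split_ifs with hq
    · subst hq
      simp only [and_true]
      rw [Finset.sum_eq_single q (fun p _ hp => by simp [hp]) (by simp)]
      simp only [if_true, ← Finset.mul_sum]
      rfl
    · simp [Ne.symm hq]
  rw [Matrix.sum_apply, Fintype.sum_sum_type, hinl, hinr, Matrix.one_apply]
  by_cases hq : q = q'
  · by_cases hu : u = u'
    · subst hq hu
      rw [if_pos rfl, if_pos rfl, if_pos rfl, ← mul_add, hsum, if_pos rfl, mul_one,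
        star_addChar_mul_self]
    · rw [if_pos hq, if_pos hq, ← mul_add, hsum, if_neg hu, mul_zero, if_neg]
      simp [hu]
  · simp [hq]

/-- Translating each index by the announced shift turns the sum into the network contraction. The
phase from each measurement cancels that of the correction at the child. Measurement and resource
each leave one factor $|I_w|^{-1/2}$, so the amplitude does not depend on `k`. -/
theorem sum_prod_vertexKraus_mul_edgeResource {Y : V → Type} [∀ v, DecidableEq (Y v)]
    {W : ∀ v, Matrix (Y v × ∀ c : R.Child v, I c) (I v) ℂ} (N : ∀ v, Matrix (I v) (I v) ℂ)
    (y0 : ∀ v, Y v) {U : Matrix (∀ v, Y v) (I R.root) ℂ}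
    (hW : ∀ y l, ∑ z : (∀ v, I v), (if z R.root = l then 1 else 0) *
        ∏ v, W v (y v, fun c => z c) (z v) = U y l)
    (k : ∀ v, BellOutcome R I v) (y : ∀ v, Y v) (l : I R.root) :
    ∑ x, (∏ v, vertexKraus (W v) (N v) (y0 v) (correction R (fun v => .inl (k v)) v) (.inl (k v))
      (y v) (x v)) * edgeResource R x l
      = (∏ w : {w : V // w ≠ R.root}, (Fintype.card (I w) : ℂ)⁻¹) * U y l := by
  rw [sum_mul_edgeResource R, ← hW, Finset.mul_sum]
  let s := correction R (fun v => .inl (k v))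
  have hs : ∀ v (c : R.Child v), s c = ((k v).1 c, (k v).2 c) := fun v c => correction_child R k c
  have hroot : s R.root = (0, 1) := correction_root R _
  refine Fintype.sum_equiv (Equiv.piCongrRight fun v => Equiv.addRight (s v).1) _ _ fun u => ?_
  have h1 : ∀ v, vertexKraus (W v) (N v) (y0 v) (s v) (.inl (k v)) (y v)
      (u v, fun c => u c) = W v (y v, fun c => u c + (s c).1) (u v + (s v).1) * (s v).2 (u v) *
        ∏ c : R.Child v, (star ((s c).2 (u c)) *
          (((1 / Real.sqrt (Fintype.card (I c)) : ℝ)) : ℂ)) := by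
    intro v
    simp only [vertexKraus, Matrix.of_apply, hs]
  have h2 : ∏ v, (s v).2 (u v) = ∏ w : {w : V // w ≠ R.root}, (s w).2 (u w) := by
    rw [← Fintype.prod_subtype_mul_prod_subtype (fun v => v ≠ R.root)]
    rw [Finset.prod_eq_one (s := (Finset.univ : Finset {v // ¬ v ≠ R.root})), mul_one]
    rintro ⟨v, hv⟩ _
    rw [not_not] at hv
    subst hv
    rw [hroot]
    rfl
  have h3 : (∏ w : {w : V // w ≠ R.root}, (s w).2 (u w)) * (∏ w : {w : V // w ≠ R.root},
      (star ((s w).2 (u w)) * (((1 / Real.sqrt (Fintype.card (I w)) : ℝ)) : ℂ))) *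
      (∏ w : {w : V // w ≠ R.root}, (((1 / Real.sqrt (Fintype.card (I w)) : ℝ)) : ℂ))
      = ∏ w : {w : V // w ≠ R.root}, (Fintype.card (I w) : ℂ)⁻¹ := by
    rw [← Finset.prod_mul_distrib, ← Finset.prod_mul_distrib]
    refine Finset.prod_congr rfl fun w _ => ?_
    rw [← sqrt_card_inv_sq]
    linear_combination ((((1 / Real.sqrt (Fintype.card (I w)) : ℝ)) : ℂ) *
      (((1 / Real.sqrt (Fintype.card (I w)) : ℝ)) : ℂ)) *
      star_addChar_mul_self (s w).2 (u w)
  change (∏ v, vertexKraus (W v) (N v) (y0 v) (s v) (.inl (k v)) (y v) (u v, fun c => u c)) * _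
    = _ * ((if u R.root + (s R.root).1 = l then 1 else 0) *
      ∏ v, W v (y v, fun c => u c + (s c).1) (u v + (s v).1))
  simp only [h1]
  rw [Finset.prod_mul_distrib, Finset.prod_mul_distrib, h2, hroot, add_zero, ← h3,
    prod_prod_child R (fun c => star ((s c).2 (u c)) *
      (((1 / Real.sqrt (Fintype.card (I c)) : ℝ)) : ℂ))]
  ring

end Teleportation

section PosSemidefFactor
open scoped MatrixOrder

theorem exists_eq_conjTranspose_mul_self {n : Type} [Fintype n] [DecidableEq n] {A : Matrix n n ℂ}
    (h : A.PosSemidef) : ∃ N : Matrix n n ℂ, A = Nᴴ * N :=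
  CStarAlgebra.nonneg_iff_eq_star_mul_self.1 h.nonneg

end PosSemidefFactor

/-! ### The spreading protocol -/

section SpreadingProtocol

variable {V : Type} [Fintype V] [DecidableEq V] {R : ParentTree V} {I : V → Type}
  [∀ v, Fintype (I v)] [∀ v, DecidableEq (I v)] [∀ v, AddCommGroup (I v)]

theorem correction_congr {o o' : ∀ v, VertexOutcome R I v} {v : V}
    (h : v ≠ R.root → o (R.par v) = o' (R.par v)) : correction R o v = correction R o' v := by
  unfold correction
  split_ifs with hv
  · rw [h hv]
  · rfl

/-- Each edge has $|I_w|^2$ Bell outcomes (a shift and a character), each of probability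
$|I_w|^{-2}$: the Bell outcomes exhaust the total probability. -/
theorem card_bellOutcome :
    (Fintype.card (∀ v, BellOutcome R I v) : ℂ) *
      ((∏ w : {w : V // w ≠ R.root}, (Fintype.card (I w) : ℂ)⁻¹) *
        ∏ w : {w : V // w ≠ R.root}, (Fintype.card (I w) : ℂ)⁻¹) = 1 := by
  have h1 : (Fintype.card (∀ v, BellOutcome R I v) : ℂ) =
      (∏ w : {w : V // w ≠ R.root}, (Fintype.card (I w) : ℂ)) *
        ∏ w : {w : V // w ≠ R.root}, (Fintype.card (I w) : ℂ) := by
    rw [← prod_prod_child R (fun c => (Fintype.card (I c) : ℂ)), ← Finset.prod_mul_distrib]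
    simp [Fintype.card_pi, Fintype.card_prod, AddChar.card_eq]
  rw [h1, mul_mul_mul_comm, ← Finset.prod_mul_distrib]
  simp

/-- If the terms `A iᴴ * A i` of a family add up to `1`, and those of a subfamily do so as well,
then the other operators of the family vanish. -/
theorem eq_zero_of_sum_eq {ι m n : Type} [Fintype ι] [DecidableEq ι] [Fintype m] [Fintype n]
    (A : ι → Matrix m n ℂ) (s : Finset ι)
    (h : ∑ i, (A i)ᴴ * A i = ∑ i ∈ s, (A i)ᴴ * A i) {i : ι} (hi : i ∉ s) : A i = 0 := by
  have h1 : ∑ i ∈ sᶜ, ((A i)ᴴ * A i).trace = 0 := by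
    rw [← Matrix.trace_sum, ← Finset.sum_add_sum_compl s] at *
    have h2 : ∑ i ∈ sᶜ, (A i)ᴴ * A i = 0 := by
      simpa using h
    rw [h2, Matrix.trace_zero]
  have h2 := (Finset.sum_eq_zero_iff_of_nonneg
    fun i _ => (Matrix.posSemidef_conjTranspose_mul_self (A i)).trace_nonneg).1 h1 i
    (Finset.mem_compl.2 hi)
  exact Matrix.trace_conjTranspose_mul_self_eq_zero_iff.1 h2

/-- The resource state with the logical system, as an isometry from the logical system. -/
def resourceIsometry {X : LocalSystems V} (E : ∀ v, X.Idx v ≃ VertexInput R I v) :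
    Matrix X.Joint (I R.root) ℂ :=
  Matrix.of fun x l => edgeResource R (fun v => E v (x v)) l

theorem exists_isFiniteLOCC_spreading {X Y : LocalSystems V}
    (E : ∀ v, X.Idx v ≃ VertexInput R I v) {U : Matrix Y.Joint (I R.root) ℂ} (hU : Uᴴ * U = 1)
    (y0 : Y.Joint) {W : ∀ v, Matrix (Y.Idx v × ∀ c : R.Child v, I c) (I v) ℂ}
    (hpsd : ∀ v, (1 - (W v)ᴴ * W v).PosSemidef)
    (hW : ∀ y l, ∑ z : (∀ v, I v), (if z R.root = l then 1 else 0) *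
        ∏ v, W v (y v, fun c => z c) (z v) = U y l) :
    ∃ S : SuperOp X Y, IsFiniteLOCC S ∧ ∀ ρ : Matrix (I R.root) (I R.root) ℂ,
      S (resourceIsometry E * ρ * (resourceIsometry E)ᴴ) = U * ρ * Uᴴ := by
  classical
  have hN : ∀ v, ∃ N : Matrix (I v) (I v) ℂ, 1 - (W v)ᴴ * W v = Nᴴ * N := fun v =>
    exists_eq_conjTranspose_mul_self (hpsd v)
  choose N hN using hN
  have : Nonempty V := ⟨R.root⟩
  let K : ∀ v, (∀ u, VertexOutcome R I u) → Matrix (Y.Idx v) (X.Idx v) ℂ := fun v o =>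
    (vertexKraus (W v) (N v) (y0 v) (correction R o v) (o v)).submatrix id (E v)
  -- Any default outcome would do.
  let d : ∀ v, VertexOutcome R I v := fun v => .inl (0, 1)
  have hpar : ∀ v, v ≠ R.root → R.par v ≠ v := fun v hv h => by
    have := R.depth_par_lt v hv
    rw [h] at this
    exact lt_irrefl _ this
  have hdep : ∀ v (o o' : ∀ u, VertexOutcome R I u), o v = o' v →
      (∀ u, R.depth u < R.depth v → o u = o' u) → K v o = K v o' := by
    intro v o o' h h'
    simp only [K]
    rw [correction_congr fun hv => h' _ (R.depth_par_lt v hv), h]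
  have hK : ∀ v (o : ∀ u, VertexOutcome R I u),
      ∑ i, (K v (Function.update o v i))ᴴ * K v (Function.update o v i) = 1 := by
    intro v o
    have h1 : ∀ i, (K v (Function.update o v i))ᴴ * K v (Function.update o v i) =
        ((vertexKraus (W v) (N v) (y0 v) (correction R o v) i)ᴴ *
          vertexKraus (W v) (N v) (y0 v) (correction R o v) i).submatrix (E v) (E v) := by
      intro i
      have h2 : correction R (Function.update o v i) v = correction R o v :=
        correction_congr fun hv => Function.update_of_ne (hpar v hv) _ _
      simp only [K, h2, Function.update_self]
      rfl
    have h3 := sum_vertexKraus_effect R (W v) (N v) (hN v) (y0 v) (correction R o v)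
    ext x x'
    have h4 := congrFun (congrFun h3 (E v x)) (E v x')
    rw [Matrix.sum_apply] at h4 ⊢
    simp only [h1, Matrix.submatrix_apply, h4, Matrix.one_apply, (E v).injective.eq_iff]
  -- The parties act in the order of depth, since the correction of a vertex needs only the outcome
  -- of its parent.
  refine ⟨_, isFiniteLOCC_sequential hdep hK d, fun ρ => ?_⟩
  set Q := resourceIsometry E with hQ
  let A : (∀ v, VertexOutcome R I v) → Matrix Y.Joint (I R.root) ℂ := fun o =>
    (tensorOp fun v => K v o) * Q
  let κ : ℂ := ∏ w : {w : V // w ≠ R.root}, (Fintype.card (I w) : ℂ)⁻¹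
  let φ : (∀ v, BellOutcome R I v) ↪ (∀ v, VertexOutcome R I v) :=
    ⟨fun k v => .inl (k v), fun k k' h => funext fun v => Sum.inl_injective (congrFun h v)⟩
  have hκ : (Fintype.card (∀ v, BellOutcome R I v) : ℂ) * (κ * κ) = 1 := card_bellOutcome
  have hκs : star κ = κ := by simp [κ]
  have hsucc : ∀ k, A (φ k) = κ • U := by
    intro k
    ext y l
    rw [Matrix.smul_apply, smul_eq_mul, ← sum_prod_vertexKraus_mul_edgeResource R N y0 hW k y l,
      ← (Equiv.piCongrRight E).sum_comp]
    rfl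
  have hQQ : Qᴴ * Q = 1 := by
    ext l l'
    rw [Matrix.one_apply, ← sum_star_edgeResource_mul R l l', ← (Equiv.piCongrRight E).sum_comp]
    rfl
  have htot : ∑ o, (A o)ᴴ * A o = 1 := by
    have h1 : ∀ o, (A o)ᴴ * A o = Qᴴ * ((tensorOp fun v => K v o)ᴴ * tensorOp fun v => K v o) * Q := by
      intro o
      simp only [A, Matrix.conjTranspose_mul, Matrix.mul_assoc]
    simp only [h1, ← Matrix.sum_mul, ← Matrix.mul_sum]
    rw [sum_sequential_effect hdep hK d, Matrix.mul_one, hQQ]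
  have hsum : ∑ o ∈ Finset.univ.map φ, (A o)ᴴ * A o = 1 := by
    rw [Finset.sum_map]
    simp only [hsucc, Matrix.conjTranspose_smul, Matrix.smul_mul, Matrix.mul_smul, hU, hκs,
      smul_smul, Finset.sum_const, Finset.card_univ]
    rw [← Nat.cast_smul_eq_nsmul ℂ, smul_smul, hκ, one_smul]
  -- The effects of all outcomes and those of the Bell outcomes alone both sum to 1 on the resource,
  -- so nothing is left for the failures.
  have hfail : ∀ o, o ∉ Finset.univ.map φ → A o = 0 := fun o ho =>
    eq_zero_of_sum_eq A _ (htot.trans hsum.symm) ho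
  have h1 : ∀ o, conjMap (tensorOp fun v => K v o) (Q * ρ * Qᴴ) = A o * ρ * (A o)ᴴ := by
    intro o
    rw [conjMap_apply]
    simp only [A, Matrix.conjTranspose_mul, Matrix.mul_assoc]
  rw [LinearMap.sum_apply]
  simp only [h1]
  rw [← Finset.sum_subset (Finset.subset_univ (Finset.univ.map φ)), Finset.sum_map]
  · simp only [hsucc, Matrix.conjTranspose_smul, Matrix.smul_mul, Matrix.mul_smul, hκs,
      smul_smul, Finset.sum_const, Finset.card_univ]
    rw [← Nat.cast_smul_eq_nsmul ℂ, smul_smul, hκ, one_smul]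
  · intro o _ ho
    rw [hfail o ho]
    simp

end SpreadingProtocol

/-! ### The resource of the graph as a resource of the rooted tree -/

section Sufficiency

variable {V : Type} [Fintype V] [DecidableEq V] {T : SimpleGraph V} [DecidableRel T.Adj]
  (hT : T.IsTree) (root : V) (D : ℕ) (M : T.edgeSet → ℕ)

/-- The labels of the system that a vertex shares with its parent, and of the logical system at
the root. -/
abbrev UpLabel (v : V) : Type :=
  (v = root → Fin D) × (∀ h : v ≠ root, Fin (M (parentEdge hT root v h)))

theorem parent_ne {v : V} (hv : v ≠ root) : parent hT root v ≠ v :=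
  (isParent_parent hT root hv).1.ne

theorem mem_parentEdge_child {v : V} (c : (rootedTree hT root).Child v) :
    v ∈ (parentEdge hT root c c.2.1 : Sym2 V) := by
  have h := parent_mem_parentEdge hT root c.2.1
  rwa [show parent hT root c = v from c.2.2] at h

theorem exists_edge_label {v : V}
    (u : VertexInput (rootedTree hT root) (UpLabel hT root D M) v) (e : T.edgeSet)
    (hv : v ∈ (e : Sym2 V)) :
    -- Labels are compared as natural numbers because `Fin (M e)` and the label type of the parent
    -- edge agree only up to an equality of edges.
    ∃ t : Fin (M e), (∀ h, parentEdge hT root v h = e → (t : ℕ) = u.1.2 h) ∧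
      ∀ (c : (rootedTree hT root).Child v) (h : (c : V) ≠ root),
        parentEdge hT root c h = e → (t : ℕ) = (u.2 c).2 h := by
  obtain ⟨w, hw, rfl⟩ := parentEdge_surjective hT root e
  rcases Sym2.mem_iff.1 hv with h | rfl
  · subst h
    refine ⟨(u.2 ⟨w, hw, rfl⟩).2 hw, fun h he => ?_, fun c h he => ?_⟩
    · exact absurd (parentEdge_injective hT root h hw he) (parent_ne hT root hw)
    · obtain ⟨c, hc⟩ := c
      obtain rfl : c = w := parentEdge_injective hT root h hw he
      rfl
  · refine ⟨u.1.2 hw, fun h he => rfl, fun c h he => ?_⟩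
    have h1 : (c : V) = v := parentEdge_injective hT root h hw he
    have h2 : parent hT root c = v := c.2.2
    exact absurd (h2.trans h1.symm) (parent_ne hT root h)

/-- The input system of a vertex, sorted into the share towards the parent and those towards the
children. -/
def vertexInputEquiv (v : V) : (inputSystems T root D M).Idx v ≃
    VertexInput (rootedTree hT root) (UpLabel hT root D M) v :=
  Equiv.ofBijective
    (fun x => ((x.1, fun h => x.2 (parentEdge hT root v h) (mem_parentEdge hT root h)),
      fun c : (rootedTree hT root).Child v => (fun h => absurd h c.2.1,
        fun h => x.2 (parentEdge hT root c h) (mem_parentEdge_child hT root c)))) (by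
    constructor
    · intro x x' hx
      beta_reduce at hx
      obtain ⟨h1, h2⟩ := Prod.mk.inj hx
      refine Prod.ext (Prod.mk.inj h1).1 ?_
      funext e he
      obtain ⟨w, hw, rfl⟩ := parentEdge_surjective hT root e
      rcases Sym2.mem_iff.1 he with h | rfl
      · exact congrFun (Prod.mk.inj (congrFun h2 ⟨w, hw, h.symm⟩)).2 hw
      · exact congrFun (Prod.mk.inj h1).2 hw
    · intro u
      choose t ht using exists_edge_label hT root D M u
      refine ⟨(u.1.1, t), Prod.ext (Prod.ext rfl ?_) ?_⟩
      · funext h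
        exact Fin.ext ((ht _ _).1 h rfl)
      · funext c
        refine Prod.ext ?_ ?_
        · funext h
          exact absurd h c.2.1
        · funext h
          exact Fin.ext ((ht _ _).2 c h rfl))

/-- The logical labels. -/
def rootLabelEquiv : UpLabel hT root D M (rootedTree hT root).root ≃ Fin D where
  toFun x := x.1 rfl
  invFun a := (fun _ => a, fun h => absurd rfl h)
  left_inv _ := Prod.ext rfl (funext fun h => absurd rfl h)
  right_inv _ := rfl

/-- The labels of the share of a vertex in the edge above it. -/
def edgeLabelEquiv {v : V} (hv : v ≠ root) :
    UpLabel hT root D M v ≃ Fin (M (parentEdge hT root v hv)) where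
  toFun x := x.2 hv
  invFun a := (fun h => absurd h hv, fun _ => a)
  left_inv _ := Prod.ext (funext fun h => absurd h hv) rfl
  right_inv _ := rfl

theorem card_upLabel {v : V} (hv : v ≠ root) [Fintype (UpLabel hT root D M v)] :
    Fintype.card (UpLabel hT root D M v) = M (parentEdge hT root v hv) := by
  rw [Fintype.card_congr (edgeLabelEquiv hT root D M hv), Fintype.card_fin]

theorem edgeResource_eq [∀ v, Fintype (UpLabel hT root D M v)]
    [∀ v, DecidableEq (UpLabel hT root D M v)] (x : (inputSystems T root D M).Joint)
    (l : UpLabel hT root D M (rootedTree hT root).root) :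
    edgeResource (rootedTree hT root) (I := UpLabel hT root D M)
        (fun v => vertexInputEquiv hT root D M v (x v)) l =
      (if (x root).1 rfl = rootLabelEquiv hT root D M l then 1 else 0) *
        resourceVec T root D M x := by
  rw [resourceVec_eq_prod hT root M x]
  refine congrArg₂ (· * ·) (if_congr ?_ rfl rfl) (Finset.prod_congr rfl fun w _ => ?_)
  · exact (rootLabelEquiv hT root D M).injective.eq_iff.symm
  · have hw := (edgeLabelEquiv hT root D M w.2).injective.eq_iff
      (a := (vertexInputEquiv hT root D M _ (x (parent hT root w))).2 ⟨w, w.2, rfl⟩)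
      (b := (vertexInputEquiv hT root D M _ (x w)).1)
    refine (if_congr hw.symm ?_ rfl)
    rw [card_upLabel hT root D M w.2]

theorem mul_mul_conjTranspose_of_apply_eq {m n k : Type} [Fintype n] [DecidableEq n] [DecidableEq k]
    {Q : Matrix m n ℂ} {f : m → k} {r : m → ℂ} (κ : n ≃ k)
    (hQ : ∀ x l, Q x l = (if f x = κ l then 1 else 0) * r x)
    (ρ : Matrix k k ℂ) (x y : m) :
    (Q * ρ.submatrix κ κ * Qᴴ) x y = ρ (f x) (f y) * (r x * star (r y)) := by
  have h1 : ∀ (z : m) (l : n), (f z = κ l) = (κ.symm (f z) = l) := fun z l => by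
    rw [Equiv.symm_apply_eq]
  simp only [Matrix.mul_apply, Matrix.conjTranspose_apply, hQ, h1, Matrix.submatrix_apply, ite_mul,
    one_mul, zero_mul, Finset.sum_ite_eq, Finset.mem_univ, if_true, apply_ite star, star_zero,
    mul_ite, mul_zero, Equiv.apply_symm_apply]
  ring

theorem initialState_eq [∀ v, Fintype (UpLabel hT root D M v)]
    [∀ v, DecidableEq (UpLabel hT root D M v)] (ρ : Matrix (Fin D) (Fin D) ℂ) :
    initialState T root M ρ =
      (resourceIsometry (R := rootedTree hT root) (vertexInputEquiv hT root D M) :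
          Matrix _ (UpLabel hT root D M (rootedTree hT root).root) ℂ) *
        ρ.submatrix (rootLabelEquiv hT root D M) (rootLabelEquiv hT root D M) *
        (resourceIsometry (R := rootedTree hT root) (vertexInputEquiv hT root D M))ᴴ := by
  ext x y
  exact (mul_mul_conjTranspose_of_apply_eq (rootLabelEquiv hT root D M)
    (fun x l => edgeResource_eq hT root D M x l) ρ x y).symm

end Sufficiency

/-- Teleportation needs shifts and characters on the labels; any abelian group structure serves. -/
theorem exists_addCommGroup (ι : Type) [Finite ι] [Nonempty ι] : Nonempty (AddCommGroup ι) := by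
  obtain ⟨n, ⟨e⟩⟩ := Finite.exists_equiv_fin ι
  have : NeZero n := ⟨by
    rintro rfl
    exact (e (Classical.arbitrary ι)).elim0⟩
  exact ⟨e.addCommGroup⟩

theorem finiteSpreadingAchievable_of_rank_le {V : Type} [Fintype V] [DecidableEq V]
    {T : SimpleGraph V} [DecidableRel T.Adj] (hT : T.IsTree) (root : V) {D : ℕ} (hD : 0 < D)
    {d : V → ℕ} (U : Matrix (∀ v, Fin (d v)) (Fin D) ℂ) (hU : Uᴴ * U = 1)
    (M : T.edgeSet → ℕ) (hM : ∀ e, 0 < M e)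
    (h : ∀ v (hv : v ≠ root),
      (codeMatrix U (subtreeAt T root v)).rank ≤ M (parentEdge hT root v hv)) :
    FiniteSpreadingAchievable T root U M := by
  classical
  let I := UpLabel hT root D M
  have hne : ∀ v, Nonempty (I v) := fun v =>
    ⟨(fun _ => ⟨0, hD⟩, fun _ => ⟨0, hM _⟩)⟩
  let _ : ∀ v, AddCommGroup (I v) := fun v => (exists_addCommGroup (I v)).some
  let κ := rootLabelEquiv hT root D M
  let U' : Matrix (∀ v, Fin (d v)) (I (rootedTree hT root).root) ℂ := U.submatrix id κ
  have hU' : U'ᴴ * U' = 1 := by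
    change Uᴴ.submatrix κ id * U.submatrix id κ = 1
    rw [← Matrix.submatrix_mul Uᴴ U κ id κ Function.bijective_id, hU,
      Matrix.submatrix_one_equiv]
  -- An isometry from a nonzero space has a nonzero target.
  obtain ⟨y0⟩ : Nonempty (∀ v, Fin (d v)) := by
    by_contra hy
    rw [not_nonempty_iff] at hy
    have := congrFun (congrFun hU ⟨0, hD⟩) ⟨0, hD⟩
    simp [Matrix.mul_apply] at this
  obtain ⟨W, hpsd, hW⟩ := exists_tree_network (rootedTree hT root) U' hU' y0
    (fun v => Classical.arbitrary (I v)) fun v hv => by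
      rw [card_upLabel hT root D M hv]
      exact (rank_sliceMatrix_le U κ y0 _).trans (h v hv)
  obtain ⟨S, hS, hS'⟩ := exists_isFiniteLOCC_spreading (R := rootedTree hT root) (I := I)
    (X := inputSystems T root D M) (Y := outputSystems d)
    (vertexInputEquiv hT root D M) (U := U') hU' y0 hpsd hW
  refine ⟨S, hS, fun ρ _ => ?_⟩
  rw [initialState_eq hT root D M ρ]
  refine (hS' _).trans ?_
  change U.submatrix id κ * ρ.submatrix κ κ * Uᴴ.submatrix κ id = U * ρ * Uᴴ
  rw [Matrix.submatrix_mul_equiv, Matrix.submatrix_mul_equiv, Matrix.submatrix_id_id]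

theorem logb_two_natCast_le_iff {a b : ℕ} (hb : 0 < b) :
    Real.logb 2 a ≤ Real.logb 2 b ↔ a ≤ b := by
  rcases Nat.eq_zero_or_pos a with rfl | ha
  -- For `a = 0` the convention that the logarithm of 0 is 0 keeps the equivalence true.
  · simp only [Nat.cast_zero, Real.logb_zero, zero_le, iff_true]
    exact Real.logb_nonneg one_lt_two (by exact_mod_cast hb)
  · rw [Real.logb_le_logb one_lt_two (by exact_mod_cast ha) (by exact_mod_cast hb), Nat.cast_le]

end

theorem theorem1 {V : Type} [Fintype V] [DecidableEq V]
    (T : SimpleGraph V) [DecidableRel T.Adj] (hT : T.IsTree) (root : V)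
    {D : ℕ} (hD : 0 < D) {d : V → ℕ}
    (U : Matrix (∀ v, Fin (d v)) (Fin D) ℂ) (hU : Uᴴ * U = 1)
    (M : T.edgeSet → ℕ) (hM : ∀ e, 0 < M e) :
    (SpreadingAchievable T root U M ↔
      ∀ (p v : V) (h : IsParent T root p v),
        Real.logb 2 (M ⟨s(p, v), h.1⟩) ≥
          Real.logb 2 ((reducedCodeState U (subtreeAt T root v)).rank)) ∧
    (FiniteSpreadingAchievable T root U M ↔ SpreadingAchievable T root U M) := by
  have : Nonempty V := ⟨root⟩
  have hfin : FiniteSpreadingAchievable T root U M → SpreadingAchievable T root U M :=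
    fun ⟨S, hS, h⟩ => ⟨S, hS.isLOCC, h⟩
  have hrank (h : SpreadingAchievable T root U M) (v : V) (hv : v ≠ root) :
      (codeMatrix U (subtreeAt T root v)).rank ≤ M (parentEdge hT root v hv) :=
    rank_codeMatrix_le hT h hv
  have hprot := finiteSpreadingAchievable_of_rank_le hT root hD U hU M hM
  -- The implications form a cycle: finite LOCC, LOCC, rank bounds, finite LOCC.
  refine ⟨⟨fun h p v hpv => ?_, fun h => hfin (hprot fun v hv => ?_)⟩,
    hfin, fun h => hprot (hrank h)⟩
  · obtain ⟨hv, rfl⟩ := (isParent_iff hT root p v).1 hpv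
    rw [ge_iff_le, logb_two_natCast_le_iff (hM _), rank_reducedCodeState hD]
    exact hrank h v hv
  · have h1 := h _ v (isParent_parent hT root hv)
    rw [ge_iff_le, logb_two_natCast_le_iff (hM _), rank_reducedCodeState hD] at h1
    exact h1
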